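/- For $n,t\ge 0$ let exact[$t$] on $n$ qubits be the $(n+1)$-qubit gate $|x\rangle|y\rangle\mapsto|x\rangle|y\oplus g(x)\rangle$, where $x\in\{0,1\}^n$, $y\in\{0,1\}$, and $g(x)=1$ iff the Hamming weight $|x|$ equals $t$. Let $\log^* n$ be the maximum number $k$ of times that the logarithm (base 2) can be iterated on $n$ with every logarithm being defined and real. A quantum circuit with fan-out acts on $n$ input qubits, one output qubit and some ancilla qubits. It is a sequence of layers; each layer consists of gates on pairwise disjoint sets of qubits, and each gate is either an arbitrary one-qubit unitary gate or a fan-out gate $|x\rangle|y_1\rangle\cdots|y_k\rangle\mapsto|x\rangle|y_1\oplus x\rangle\cdots|y_k\oplus x\rangle$ (the controlled-not gate is the case $k=1$). The depth is the number of layers, and the size is the sum over all gates of the number of affected qubits. The circuit computes a gate on the input and output qubits exactly if, with all ancillas starting in $|0\rangle$, it performs that gate without error and returns all ancillas to $|0\rangle$. A family of circuits $C_{n,t}$ is uniform if one Turing machine, given $1^n01^t$, prints a description of $C_{n,t}$ in work space $O(\log(n+t+2))$. In such a description every one-qubit gate is given as a finite product of Hadamard gates and rotations $R_z(2\pi p/q)=|0\rangle\langle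 0|+e^{2\pi i p/q}|1\rangle\langle 1|$, and the integers $p,q\ge 0$ and the numbers of the qubits are written in unary (for $q=0$ the angle is read as $0$). **Theorem.** exact[$t$] $\in\mathrm{QNC}_{\mathrm f}(\log^* n)$: there is a uniform family of circuits $C_{n,t}$ with fan-out, of depth $O(\log^* n)$ and polynomial size, such that $C_{n,t}$ computes exact[$t$] on $n$ qubits exactly, for all $n,t\ge 0$. Moreover, there is such a family of depth $O(\log^* n)$ and size $O(n\log n)$. The constants in the $O$-bounds for depth and size, which hold for all sufficiently large $n$, do not depend on $t$. -/

import Mathlib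

noncomputable section

namespace FanoutCircuit

/-! ### The log-star function -/

/-- The `k`-times iterated base-two logarithm of `x` exists and is real: each of the `k` successive
logarithms is taken of a positive number. -/
def IterLogExists (k : ℕ) (x : ℝ) : Prop :=
  ∀ j < k, 0 < (Real.logb 2)^[j] x

/-- `log* x`, the maximum number `k` such that the `k`-times iterated logarithm of `x` exists. -/
def logStar (x : ℝ) : ℕ :=
  sSup {k : ℕ | IterLogExists k x}

theorem logb_two_le (x : ℝ) (hx : 0 < x) : Real.logb 2 x ≤ x - 1 / 2 := by
  have h2 : (0.6931471803 : ℝ) < Real.log 2 := Real.log_two_gt_d9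
  have h2' : Real.log 2 < 0.6931471808 := Real.log_two_lt_d9
  have hsplit : Real.log x = Real.log (x * (2 / 3)) + Real.log (3 / 2) := by
    rw [← Real.log_mul (by positivity) (by norm_num)]
    congr 1
    ring
  have e1 := Real.log_le_sub_one_of_pos (show 0 < x * (2 / 3) by positivity)
  have e2 := Real.log_le_sub_one_of_pos (show (0 : ℝ) < 3 / 2 by norm_num)
  rw [Real.logb, div_le_iff₀ (by linarith)]
  nlinarith

/-- The maximum in the definition of `log*` is attained. -/
theorem isGreatest_logStar (x : ℝ) : IsGreatest {k : ℕ | IterLogExists k x} (logStar x) := by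
  have hb : BddAbove {k : ℕ | IterLogExists k x} := by
    refine ⟨⌈2 * x⌉₊ + 1, ?_⟩
    intro k hk
    by_contra hlt
    push Not at hlt
    have key : ∀ j : ℕ, j < k → (Real.logb 2)^[j] x ≤ x - j / 2 := by
      intro j
      induction j with
      | zero => intro _; simp
      | succ j ih =>
        intro hj
        have h1 := ih (by omega)
        have h3 := logb_two_le _ (hk j (by omega))
        rw [Function.iterate_succ_apply']
        push_cast
        linarith
    have h1 := key (⌈2 * x⌉₊ + 1) hlt
    have h2 := hk (⌈2 * x⌉₊ + 1) hlt
    have h3 := Nat.le_ceil (2 * x)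
    push_cast at h1
    linarith
  exact ⟨Nat.sSup_mem ⟨0, fun j hj => absurd hj (Nat.not_lt_zero j)⟩ hb,
    fun k hk => le_csSup hb hk⟩

/-! ### Quantum circuits with fan-out and arbitrary one-qubit gates -/

/-- The qubits of a circuit: `n` input qubits, one output qubit, and `a` ancilla qubits. -/
abbrev Wire (n a : ℕ) : Type := Fin n ⊕ Fin 1 ⊕ Fin a

/-- The gates on qubits `W`: a one-qubit gate `U` from `G` applied to qubit `i`, or the fan-out gate
with control qubit `c` and target qubits `T`. The controlled-not gate is a fan-out gate with one
target. -/
inductive Gate (G W : Type) : Type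
  | one (U : G) (i : W)
  | fanout (c : W) (T : List W)

namespace Gate

variable {G G' W : Type}

/-- The qubits affected by a gate. -/
def qubits : Gate G W → List W
  | one _ i => [i]
  | fanout c T => c :: T

/-- The size of a gate is the number of affected qubits. -/
def size (g : Gate G W) : ℕ := g.qubits.length

/-- Replace the one-qubit gates. -/
def map (f : G → G') : Gate G W → Gate G' W
  | one U i => one (f U) i
  | fanout c T => fanout c T

theorem qubits_map (f : G → G') (g : Gate G W) : (g.map f).qubits = g.qubits := by
  cases g <;> rfl

end Gate

/-- The group of one-qubit gates; the basis states are indexed by `Bool`. -/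
abbrev OneQubitGate : Type := Matrix.unitaryGroup Bool ℂ

/-- A (not necessarily normalised) state of the qubits `W`: its amplitudes in the computational
basis. -/
abbrev State (W : Type) : Type := (W → Bool) → ℂ

/-- The action of a gate on states. The fan-out gate maps the basis state `b` to the basis state in
which the bit `b c` has been added modulo two to every target bit; it is an involution, so that the
amplitude of `b` after it is the amplitude before it of the basis state to which it maps `b`. -/
def Gate.apply {W : Type} [DecidableEq W] : Gate OneQubitGate W → State W → State W
  | .one U i, ψ => fun b => ∑ c : Bool, (U : Matrix Bool Bool ℂ) (b i) c * ψ (Function.update b i c)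
  | .fanout c T, ψ => fun b => ψ (fun j => if j ∈ T then xor (b j) (b c) else b j)

/-- A circuit: a list of layers, each a list of gates that affect pairwise distinct qubits. -/
structure Circuit (G : Type) (n a : ℕ) : Type where
  layers : List (List (Gate G (Wire n a)))
  nodup : ∀ L ∈ layers, (L.flatMap Gate.qubits).Nodup

namespace Circuit

variable {G G' : Type} {n a : ℕ}

/-- The depth is the number of layers. -/
def depth (C : Circuit G n a) : ℕ := C.layers.length

/-- The size is the total size of all gates. -/
def size (C : Circuit G n a) : ℕ := (C.layers.flatten.map Gate.size).sum

/-- Replace the one-qubit gates. -/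
def map (f : G → G') (C : Circuit G n a) : Circuit G' n a where
  layers := C.layers.map (List.map (Gate.map f))
  nodup := by
    intro L hL
    obtain ⟨L', hL', rfl⟩ := List.mem_map.1 hL
    have h := C.nodup L' hL'
    rw [List.flatMap_map]
    simpa only [Gate.qubits_map] using h

/-- The operator computed by a circuit; the first layer is applied first. -/
def run (C : Circuit OneQubitGate n a) (ψ : State (Wire n a)) : State (Wire n a) :=
  C.layers.flatten.foldl (fun φ g => g.apply φ) ψ

end Circuit

/-- The basis state with input bits `x`, output bit `y`, and all ancilla qubits zero. -/
def inputState {n : ℕ} (a : ℕ) (x : Fin n → Bool) (y : Bool) : State (Wire n a) :=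
  Pi.single (Sum.elim x (Sum.elim (fun _ => y) (fun _ => false))) 1

/-- The circuit computes, without error and with clean ancilla qubits at the end, the
`(n+1)`-qubit gate that maps `|x⟩|y⟩` to `|x⟩|y ⊕ g(x)⟩`. -/
def Circuit.ComputesExactly {n a : ℕ} (C : Circuit OneQubitGate n a)
    (g : (Fin n → Bool) → Bool) : Prop :=
  ∀ (x : Fin n → Bool) (y : Bool), C.run (inputState a x y) = inputState a x (xor y (g x))

/-! ### Descriptions of circuits -/

/-- The Hadamard gate. -/
def hadamard : OneQubitGate :=
  ⟨Matrix.of fun i j : Bool => if i && j then -(1 / (√2 : ℂ)) else 1 / (√2 : ℂ), by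
    have h : (1 / (√2 : ℂ)) * (1 / (√2 : ℂ)) = 1 / 2 := by
      rw [div_mul_div_comm, one_mul, ← Complex.ofReal_mul,
        Real.mul_self_sqrt (by norm_num)]
      norm_num
    rw [Matrix.mem_unitaryGroup_iff]
    ext i j
    cases i <;> cases j <;>
      simp [Matrix.mul_apply, Matrix.star_apply] <;>
      (simp only [one_div] at h; rw [h]; norm_num)⟩

/-- The rotation `|0⟩⟨0| + e^{iα}|1⟩⟨1|` around the z-axis. -/
def rotationZ (α : ℝ) : OneQubitGate :=
  ⟨Matrix.diagonal fun i : Bool => if i then Complex.exp (α * Complex.I) else 1, by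
    have h : Complex.exp (α * Complex.I) * (starRingEnd ℂ) (Complex.exp (α * Complex.I)) = 1 := by
      rw [Complex.mul_conj, Complex.normSq_eq_norm_sq, Complex.norm_exp_ofReal_mul_I]
      norm_num
    rw [Matrix.mem_unitaryGroup_iff, Matrix.star_eq_conjTranspose, Matrix.diagonal_conjTranspose,
      Matrix.diagonal_mul_diagonal, ← Matrix.diagonal_one]
    congr 1
    ext i
    cases i
    · simp
    · simpa using h⟩

/-- The letters in the finite description of a one-qubit gate: the Hadamard gate, and the rotation
around the z-axis by the angle `2πp/q`. -/
inductive Letter : Type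
  | H
  | Rz (p q : ℕ)

/-- The gate denoted by a letter (for `q = 0` the angle is read as zero). -/
def Letter.gate : Letter → OneQubitGate
  | H => hadamard
  | Rz p q => rotationZ (2 * Real.pi * p / q)

/-- A finitely described one-qubit gate: a word that denotes the product of its letters. The
denoted gates form a dense subgroup of the group of all one-qubit gates. -/
abbrev GateWord : Type := List Letter

/-- The gate denoted by a word. -/
def GateWord.gate (w : GateWord) : OneQubitGate := (w.map Letter.gate).prod

/-- The alphabet of circuit descriptions. -/
inductive Symbol : Type
  | tick
  | sep
  | had
  | rot
  | one
  | fan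
  | layer

/-- A number, in unary. -/
def encodeNat (k : ℕ) : List Symbol := List.replicate k .tick ++ [.sep]

/-- The number of a qubit: first the input qubits, then the output qubit, then the ancillas. -/
def Wire.index {n a : ℕ} : Wire n a → ℕ
  | .inl i => i
  | .inr (.inl _) => n
  | .inr (.inr j) => n + 1 + j

def Letter.encode : Letter → List Symbol
  | H => [.had]
  | Rz p q => .rot :: (encodeNat p ++ encodeNat q)

def Gate.encode {n a : ℕ} : Gate GateWord (Wire n a) → List Symbol
  | one w i => .one :: (w.flatMap Letter.encode ++ encodeNat (Wire.index i))
  | fanout c T => .fan :: (encodeNat (Wire.index c) ++ T.flatMap fun i => encodeNat (Wire.index i))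

/-- The description of a circuit: the numbers of input and ancilla qubits, followed by the gates,
layer by layer. -/
def Circuit.encode {n a : ℕ} (D : Circuit GateWord n a) : List Symbol :=
  encodeNat n ++ encodeNat a ++ D.layers.flatMap fun L => .layer :: L.flatMap Gate.encode

/-! ### Logarithmic-space Turing machines -/

/-- The moves of a tape head. -/
inductive Move : Type
  | left
  | stay
  | right

/-- The new position of a head on a tape with cells `0, 1, 2, …`. -/
def Move.pos : Move → ℕ → ℕ
  | left, p => p - 1
  | stay, p => p
  | right, p => p + 1

/-- A deterministic Turing machine with a two-way read-only input tape, finitely many read-write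
work tapes, and a one-way write-only output tape. The transition function sees the state, the
scanned input symbol (`none` for an end marker) and the scanned work symbols; it yields the new
state, the move of the input head, the symbol to write and the move on every work tape, and
possibly an output symbol. The machine halts where the transition function yields `none`. -/
structure Machine (Γ : Type) : Type 1 where
  Q : Type
  finite_Q : Finite Q
  A : Type
  finite_A : Finite A
  tapes : ℕ
  start : Q
  blank : A
  trans : Q → Option Bool → (Fin tapes → A) →
    Option (Q × Move × (Fin tapes → A × Move) × Option Γ)

namespace Machine

variable {Γ : Type}

/-- A configuration of a machine. -/
structure Config (M : Machine Γ) : Type where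
  state : M.Q
  inPos : ℕ
  work : Fin M.tapes → ℕ → M.A
  head : Fin M.tapes → ℕ
  out : List Γ

/-- The initial configuration; the input head is on the left end marker. -/
def init (M : Machine Γ) : M.Config where
  state := M.start
  inPos := 0
  work := fun _ _ => M.blank
  head := fun _ => 0
  out := []

/-- The symbol in cell `p` of the input tape: `w` is in cells `1, …, |w|`, between end markers in
the cells `0` and `|w| + 1`. -/
def inputSymbol (w : List Bool) : ℕ → Option Bool
  | 0 => none
  | p + 1 => w[p]?

/-- One step on input `w`; the input head does not leave the cells `0, …, |w| + 1`. -/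
def next (M : Machine Γ) (w : List Bool) (c : M.Config) : Option M.Config :=
  (M.trans c.state (inputSymbol w c.inPos) fun i => c.work i (c.head i)).map
    fun (q, m, act, o) =>
      { state := q
        inPos := min (m.pos c.inPos) (w.length + 1)
        work := fun i => Function.update (c.work i) (c.head i) (act i).1
        head := fun i => (act i).2.pos (c.head i)
        out := c.out ++ o.toList }

/-- The configuration `c` occurs in the run on input `w`. -/
def Reaches (M : Machine Γ) (w : List Bool) (c : M.Config) : Prop :=
  StateTransition.Reaches (M.next w) M.init c

end Machine

/-- The pair `(n, t)` as an input word, in unary. -/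
def unaryPair (n t : ℕ) : List Bool :=
  List.replicate n true ++ false :: List.replicate t true

/-- The words `f n t` are generated from `(n, t)`, given in unary, by one Turing machine whose work
heads stay within logarithmically many cells. -/
def LogSpaceGenerated {Γ : Type} (f : ℕ → ℕ → List Γ) : Prop :=
  ∃ (M : Machine Γ) (k : ℕ), ∀ n t : ℕ,
    (∃ c, M.Reaches (unaryPair n t) c ∧ M.next (unaryPair n t) c = none ∧ c.out = f n t) ∧
    ∀ c, M.Reaches (unaryPair n t) c →
      ∀ i, c.head i ≤ k * Nat.log 2 ((unaryPair n t).length + 2)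

/-! ### Circuit classes -/

/-- A family of circuits, for input size `n` and parameter `t`, is uniform if descriptions of its
members are generated in logarithmic space. -/
def Uniform {anc : ℕ → ℕ → ℕ} (C : ∀ n t, Circuit OneQubitGate n (anc n t)) : Prop :=
  ∃ D : ∀ n t, Circuit GateWord n (anc n t),
    (∀ n t, C n t = (D n t).map GateWord.gate) ∧
    LogSpaceGenerated fun n t => (D n t).encode

/-- The gates `|x⟩|y⟩ ↦ |x⟩|y ⊕ g n t x⟩`, where `x` has `n` bits and `t` is a parameter, are
computed exactly by a uniform family of quantum circuits with fan-out of depth `O(d(n))` and size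
`O(s(n))`; the constants do not depend on the parameter. -/
def ComputableExactly (d s : ℕ → ℝ) (g : ∀ n : ℕ, ℕ → (Fin n → Bool) → Bool) : Prop :=
  ∃ (anc : ℕ → ℕ → ℕ) (C : ∀ n t, Circuit OneQubitGate n (anc n t)),
    Uniform C ∧
    (∀ n t, (C n t).ComputesExactly (g n t)) ∧
    ∃ (K : ℝ) (n₀ : ℕ), ∀ n ≥ n₀, ∀ t,
      ((C n t).depth : ℝ) ≤ K * d n ∧ ((C n t).size : ℝ) ≤ K * s n

/-- The class `QNC_f(d(n))`, with arbitrary one-qubit gates: depth `O(d(n))`, polynomial size. -/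
def QNCf (d : ℕ → ℝ) : Set (∀ n : ℕ, ℕ → (Fin n → Bool) → Bool) :=
  {g | ∃ e : ℕ, ComputableExactly d (fun n => (n : ℝ) ^ e) g}

/-- The Hamming weight. -/
def weight {n : ℕ} (x : Fin n → Bool) : ℕ := (Finset.univ.filter fun i => x i = true).card

/-- The function of the exact[t] gate on `n` input qubits. -/
def exact (n t : ℕ) (x : Fin n → Bool) : Bool := decide (weight x = t)

end FanoutCircuit

end

noncomputable section

namespace FanoutCircuit

/-! ### Register programs with output -/

/-! The circuit has depth 30 for all n and t. The bound O(log* n) follows because log* n ≥ 1 for n ≥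
1.

Counting. Let m = ⌈log₂(n + 2)⌉ and w = min(t, n + 1) - |x|, so that w = 0 iff |x| = t, and |w| <
2^m. Counter k < m is brought into the uniform superposition by a Hadamard gate and spread by
fan-out over n + 1 qubits, which are rotated by angles ±2π/2^(k+2): one round with directions that
depend on t, and one round while x_i is added to copy i. All these phases accumulate on the single
counter: up to a factor that depends only on x, its state |1⟩ receives the phase ω_k = exp(2πi
w/2^(k+1)) (`countPhase_supported`). A second Hadamard gate leaves the amplitudes (1 + ω_k)/2 and (1
- ω_k)/2. If w = 0, every counter is certainly zero. If w = ±2^v u with u odd, then v < m and ω_v =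
-1, so that counter v is certainly one (`exists_zeta_zpow_eq_neg_one`). Hence "all counters are
zero" has a definite truth value, namely g(x), even though single counters may stay in
superposition.

Sign. For c ∈ {0,1}^m the sum of (-1)^(a·c) over all a ∈ {0,1}^m is 2^m if c = 0, and 0 otherwise
(`sum_sgn_parity`). Since 2^m = O(n), all parities a·c can be computed side by side; a fan-out gate
between Hadamard gates is a parity gate (`isPerm_parity`). If every parity contributes the phase
ζ^(±1), where ζ has order 2^(m+1), the total phase is ζ^(2^m) = -1 for c = 0 and 1 otherwise.
Interleaving opposite rotations with additions of the output bit makes this conditional on that bit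
(`signLayers_apply`).

Output. Hadamard gates on the output qubit turn the conditional sign into a bit flip. The counting
layers with reversed rotations restore the ancillas exactly (`countLayers_inv`). A layer touches
each qubit at most once, and there are O(nm + m 2^m) = O(n log n) qubits, which bounds the size.

Uniformity. A small language with scoped registers (`Gen`) prints the description by nested loops.
It is compiled to register programs (`Imp`), and these to a Turing machine that keeps all registers
in binary on parallel tracks of one work tape. The control stacks of a program are finitely many,
hence fit into the states, and registers of polynomial size need logarithmically many cells. -/

/-- A test on registers: `<`, or whether the binary expansions have a common digit one. -/
inductive Cond (R : ℕ) : Type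
  | lt (i j : Fin R)
  | meet (i j : Fin R)

/-- Truth of a test. -/
def Cond.holds {R : ℕ} (σ : Fin R → ℕ) : Cond R → Bool
  | lt i j => decide (σ i < σ j)
  | meet i j => decide (σ i &&& σ j ≠ 0)

/-- Programs with registers, an output and a one-way head on the input word. The assignment
`assign v i j c` is `v := i + j + c`, where an absent operand is zero. -/
inductive Imp (R : ℕ) (Γ : Type) : Type
  | skip
  | emit (s : Γ)
  | seq (p q : Imp R Γ)
  | assign (v : Fin R) (i j : Option (Fin R)) (c : Bool)
  | loop (c : Cond R) (p : Imp R Γ)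
  | ite (c : Cond R) (p q : Imp R Γ)
  | move
  | loopIn (p : Imp R Γ)

/-- The value of an operand. -/
def operand {R : ℕ} (σ : Fin R → ℕ) (i : Option (Fin R)) : ℕ := i.elim 0 σ

/-- A configuration of a register program: the programs still to be executed, the position of the
input head, the registers, and the output. -/
structure ImpConfig (R : ℕ) (Γ : Type) : Type where
  stack : List (Imp R Γ)
  pos : ℕ
  regs : Fin R → ℕ
  out : List Γ

namespace Imp

variable {R : ℕ} {Γ : Type}

/-- The step of an instruction that does not touch the registers. -/
def simpleStep (s : Option Bool) (K : List (Imp R Γ)) :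
    Imp R Γ → Option (List (Imp R Γ) × Move × Option Γ)
  | skip => some (K, .stay, none)
  | emit a => some (K, .stay, some a)
  | seq p q => some (p :: q :: K, .stay, none)
  | move => some (K, .right, none)
  | loopIn p => some (if s = some true then p :: loopIn p :: K else K, .stay, none)
  | _ => none

/-- The registers after an instruction. -/
def effectRegs (σ : Fin R → ℕ) : Imp R Γ → Fin R → ℕ
  | assign v i j c => Function.update σ v (operand σ i + operand σ j + c.toNat)
  | _ => σ

/-- The remaining programs after an instruction that acts on registers, where `b` is the value of
the test. -/
def branch (K : List (Imp R Γ)) (b : Bool) : Imp R Γ → List (Imp R Γ)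
  | loop c p => if b then p :: loop c p :: K else K
  | ite _ p q => if b then p :: K else q :: K
  | _ => K

/-- The value of the test of an instruction. -/
def testValue (σ : Fin R → ℕ) : Imp R Γ → Bool
  | loop c _ => c.holds σ
  | ite c _ _ => c.holds σ
  | _ => false

/-- One step on input `w`. -/
def next (w : List Bool) (c : ImpConfig R Γ) : Option (ImpConfig R Γ) :=
  match c.stack with
  | [] => none
  | p :: K =>
    match simpleStep (Machine.inputSymbol w c.pos) K p with
    | some (K', m, o) => some ⟨K', min (m.pos c.pos) (w.length + 1), c.regs, c.out ++ o.toList⟩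
    | none => some ⟨branch K (testValue c.regs p) p, c.pos, effectRegs c.regs p, c.out⟩

/-! ### The finitely many stacks of a program -/

/-- The stacks that occur while `p` is executed on top of `K`. -/
def reach : Imp R Γ → List (Imp R Γ) → List (List (Imp R Γ))
  | skip, K => [skip :: K]
  | emit s, K => [emit s :: K]
  | seq p q, K => (seq p q :: K) :: (reach p (q :: K) ++ reach q K)
  | assign v i j c, K => [assign v i j c :: K]
  | loop c p, K => (loop c p :: K) :: reach p (loop c p :: K)
  | ite c p q, K => (ite c p q :: K) :: (reach p K ++ reach q K)
  | move, K => [move :: K]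
  | loopIn p, K => (loopIn p :: K) :: reach p (loopIn p :: K)

theorem mem_reach_self (p : Imp R Γ) (K : List (Imp R Γ)) : p :: K ∈ reach p K := by
  cases p <;> simp [reach]

/-- The stacks that occur in the run of a program. -/
def runStacks (p : Imp R Γ) : List (List (Imp R Γ)) := [] :: reach p []

/-- A step only replaces the top program by parts of it, possibly above the same loop or the second
half of a sequence, and nothing below is touched until it is exposed. So the stack is determined by
a place in the syntax tree of `p`. This finiteness lets the stack become a machine state. -/
theorem reach_closed (p : Imp R Γ) : ∀ (K : List (Imp R Γ)) (q : Imp R Γ) (K₁ : List (Imp R Γ)),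
    q :: K₁ ∈ reach p K →
    (∀ s K₂ m o, simpleStep s K₁ q = some (K₂, m, o) → K₂ ∈ reach p K ∨ K₂ = K) ∧
    (∀ s b, simpleStep s K₁ q = none → branch K₁ b q ∈ reach p K ∨ branch K₁ b q = K) := by
  induction p with
  | skip | emit _ | assign _ _ _ _ | move =>
    intro K q K₁ h
    simp only [reach, List.mem_singleton, List.cons.injEq] at h
    obtain ⟨rfl, rfl⟩ := h
    refine ⟨?_, ?_⟩ <;> simp +contextual [simpleStep, branch]
  | seq p₁ p₂ ih₁ ih₂ =>
    intro K q K₁ h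
    simp only [reach, List.mem_cons, List.mem_append, List.cons.injEq] at h ⊢
    rcases h with ⟨rfl, rfl⟩ | h | h
    · have := mem_reach_self p₁ (p₂ :: K₁)
      refine ⟨?_, ?_⟩ <;> simp +contextual [simpleStep, this]
    · have h2 := mem_reach_self p₂ K
      obtain ⟨a, b⟩ := ih₁ _ _ _ h
      refine ⟨fun s K₂ m o e => ?_, fun s b' e => ?_⟩
      · rcases a s K₂ m o e with h | rfl <;> simp [*]
      · rcases b s b' e with h | h <;> simp [*]
    · obtain ⟨a, b⟩ := ih₂ _ _ _ h
      refine ⟨fun s K₂ m o e => ?_, fun s b' e => ?_⟩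
      · rcases a s K₂ m o e with h | rfl <;> simp [*]
      · rcases b s b' e with h | h <;> simp [*]
  | ite c p₁ p₂ ih₁ ih₂ =>
    intro K q K₁ h
    simp only [reach, List.mem_cons, List.mem_append, List.cons.injEq] at h ⊢
    rcases h with ⟨rfl, rfl⟩ | h | h
    · have h1 := mem_reach_self p₁ K₁
      have h2 := mem_reach_self p₂ K₁
      refine ⟨by simp [simpleStep], fun s b _ => ?_⟩
      cases b <;> simp [branch, h1, h2]
    · obtain ⟨a, b⟩ := ih₁ _ _ _ h
      refine ⟨fun s K₂ m o e => ?_, fun s b' e => ?_⟩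
      · rcases a s K₂ m o e with h | rfl <;> simp [*]
      · rcases b s b' e with h | h <;> simp [*]
    · obtain ⟨a, b⟩ := ih₂ _ _ _ h
      refine ⟨fun s K₂ m o e => ?_, fun s b' e => ?_⟩
      · rcases a s K₂ m o e with h | rfl <;> simp [*]
      · rcases b s b' e with h | h <;> simp [*]
  | loop c p ih =>
    intro K q K₁ h
    simp only [reach, List.mem_cons, List.cons.injEq] at h ⊢
    rcases h with ⟨rfl, rfl⟩ | h
    · have h1 := mem_reach_self p (loop c p :: K₁)
      refine ⟨by simp [simpleStep], fun s b _ => ?_⟩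
      cases b <;> simp [branch, h1]
    · obtain ⟨a, b⟩ := ih _ _ _ h
      refine ⟨fun s K₂ m o e => ?_, fun s b' e => ?_⟩
      · rcases a s K₂ m o e with h | rfl <;> simp [*]
      · rcases b s b' e with h | h <;> simp [*]
  | loopIn p ih =>
    intro K q K₁ h
    simp only [reach, List.mem_cons, List.cons.injEq] at h ⊢
    rcases h with ⟨rfl, rfl⟩ | h
    · have h1 := mem_reach_self p (loopIn p :: K₁)
      refine ⟨fun s K₂ m o e => ?_, fun s b e => by simp [simpleStep] at e⟩
      simp only [simpleStep, Option.some.injEq, Prod.mk.injEq] at e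
      obtain ⟨rfl, -⟩ := e
      split_ifs <;> simp [h1]
    · obtain ⟨a, b⟩ := ih _ _ _ h
      refine ⟨fun s K₂ m o e => ?_, fun s b' e => ?_⟩
      · rcases a s K₂ m o e with h | rfl <;> simp [*]
      · rcases b s b' e with h | h <;> simp [*]

theorem runStacks_closed {p q : Imp R Γ} {K : List (Imp R Γ)} (h : q :: K ∈ runStacks p) :
    (∀ s K₂ m o, simpleStep s K q = some (K₂, m, o) → K₂ ∈ runStacks p) ∧
    (∀ s b, simpleStep s K q = none → branch K b q ∈ runStacks p) := by
  simp only [runStacks, List.mem_cons, reduceCtorEq, false_or] at h ⊢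
  obtain ⟨a, b⟩ := reach_closed p [] q K h
  exact ⟨fun s K₂ m o e => (a s K₂ m o e).symm, fun s b' e => (b s b' e).symm⟩

/-! ### Binary registers on parallel tracks -/

/-- A digit of every register. -/
abbrev Digit (R : ℕ) : Type := Fin R → Bool

/-- The values of registers written in binary, least significant digits first. -/
def val : List (Digit R) → Fin R → ℕ
  | [], _ => 0
  | d :: ds, r => (d r).toNat + 2 * val ds r

theorem val_append (ds es : List (Digit R)) (r : Fin R) :
    val (ds ++ es) r = val ds r + 2 ^ ds.length * val es r := by
  induction ds with
  | nil => simp [val]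
  | cons d ds ih => simp only [List.cons_append, val, ih, List.length_cons, pow_succ]; ring

/-- The digit of an operand. -/
def opDigit (d : Digit R) (i : Option (Fin R)) : Bool := i.elim false d

theorem operand_val_cons (d : Digit R) (ds : List (Digit R)) (i : Option (Fin R)) :
    operand (val (d :: ds)) i = (opDigit d i).toNat + 2 * operand (val ds) i := by
  cases i <;> simp [operand, opDigit, val]

/-- The processing of one digit in a test. -/
def testDigit (d : Digit R) (c : Bool) : Cond R → Bool
  | .lt i j => bif d i == d j then c else d j
  | .meet i j => c || (d i && d j)

/-- The processing of one digit by an instruction; `c` is the carry. -/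
def digitStep (p : Imp R Γ) (d : Digit R) (c : Bool) : Digit R × Bool :=
  match p with
  | assign v i j _ => (Function.update d v ((opDigit d i ^^ opDigit d j) ^^ c),
      (opDigit d i && opDigit d j) || (c && (opDigit d i || opDigit d j)))
  | loop t _ => (d, testDigit d c t)
  | ite t _ _ => (d, testDigit d c t)
  | _ => (d, c)

/-- The initial carry. -/
def initCarry : Imp R Γ → Bool
  | assign _ _ _ c => c
  | _ => false

/-- The digit written at the end of a sweep. -/
def overflow (c : Bool) : Imp R Γ → Option (Digit R)
  | assign v _ _ _ => bif c then some (Function.update (fun _ => false) v true) else none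
  | _ => none

/-- The processing of all digits. -/
def sweep (p : Imp R Γ) : Bool → List (Digit R) → List (Digit R) × Bool
  | c, [] => ([], c)
  | c, d :: ds => ((digitStep p d c).1 :: (sweep p (digitStep p d c).2 ds).1,
      (sweep p (digitStep p d c).2 ds).2)

theorem length_sweep (p : Imp R Γ) (c : Bool) (ds : List (Digit R)) :
    (sweep p c ds).1.length = ds.length := by
  induction ds generalizing c with
  | nil => rfl
  | cons d ds ih => simp [sweep, ih]

theorem sweep_assign_ne (v : Fin R) (i j : Option (Fin R)) (c₀ c : Bool) (ds : List (Digit R))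
    (r : Fin R) (hr : r ≠ v) :
    val (sweep (assign v i j c₀ : Imp R Γ) c ds).1 r = val ds r := by
  induction ds generalizing c with
  | nil => rfl
  | cons d ds ih => simp [sweep, val, ih, digitStep, hr]

/-- Correctness of ripple-carry addition: the outgoing carry stands for a digit of weight `2 ^
ds.length`. The digits of a column are read before `v` is overwritten there, so `v` may itself be an
operand. -/
theorem sweep_assign (v : Fin R) (i j : Option (Fin R)) (c₀ c : Bool) (ds : List (Digit R)) :
    val (sweep (assign v i j c₀ : Imp R Γ) c ds).1 v +
      2 ^ ds.length * (sweep (assign v i j c₀ : Imp R Γ) c ds).2.toNat =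
    operand (val ds) i + operand (val ds) j + c.toNat := by
  induction ds generalizing c with
  | nil => cases i <;> cases j <;> simp [sweep, val, operand]
  | cons d ds ih =>
    rw [operand_val_cons, operand_val_cons]
    have h := ih (digitStep (assign v i j c₀ : Imp R Γ) d c).2
    simp only [sweep, val, List.length_cons, pow_succ]
    rw [show ∀ a b x y : ℕ, a + 2 * b + x * 2 * y = a + 2 * (b + x * y) from
      fun _ _ _ _ => by ring, h]
    simp only [digitStep, Function.update_self]
    cases opDigit d i <;> cases opDigit d j <;> cases c <;> simp <;> omega

/-- A test leaves the tape unchanged, and its sweep is a fold over the digits. -/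
theorem sweep_of_digitStep (p : Imp R Γ) (f : Digit R → Bool → Bool)
    (hp : ∀ d c, digitStep p d c = (d, f d c)) (c : Bool) (ds : List (Digit R)) :
    sweep p c ds = (ds, ds.foldl (fun c d => f d c) c) := by
  induction ds generalizing c with
  | nil => rfl
  | cons d ds ih => simp [sweep, hp, ih]

/-- Digits come least significant first, so the last differing digit decides; `c` is the verdict of
the digits already read. -/
theorem foldl_testDigit_lt (i j : Fin R) (c : Bool) (ds : List (Digit R)) :
    ds.foldl (fun c d => testDigit d c (.lt i j)) c =
      decide (val ds i < val ds j ∨ (val ds i = val ds j ∧ c = true)) := by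
  induction ds generalizing c with
  | nil => simp [val]
  | cons d ds ih =>
    rw [List.foldl_cons, ih]
    refine decide_eq_decide.2 ?_
    simp only [testDigit, val]
    cases d i <;> cases d j <;> cases c <;> simp <;> omega

theorem land_ne_zero_cons (a b : Bool) (x y : ℕ) :
    (a.toNat + 2 * x) &&& (b.toNat + 2 * y) ≠ 0 ↔ (a && b) = true ∨ x &&& y ≠ 0 := by
  have h : ∀ (a : Bool) (x : ℕ), a.toNat + 2 * x = Nat.bit a x := by
    intro a x; cases a <;> simp [Nat.bit]; omega
  rw [h, h, Nat.land_bit]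
  cases a <;> cases b <;> simp [Nat.bit]

theorem foldl_testDigit_meet (i j : Fin R) (c : Bool) (ds : List (Digit R)) :
    ds.foldl (fun c d => testDigit d c (.meet i j)) c =
      decide (c = true ∨ val ds i &&& val ds j ≠ 0) := by
  induction ds generalizing c with
  | nil => simp [val]
  | cons d ds ih =>
    rw [List.foldl_cons, ih, decide_eq_decide]
    simp only [val]
    rw [land_ne_zero_cons]
    simp only [testDigit]
    simp [or_assoc]

theorem foldl_testDigit (t : Cond R) (ds : List (Digit R)) :
    ds.foldl (fun c d => testDigit d c t) false = t.holds (val ds) := by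
  cases t with
  | lt i j => simp [foldl_testDigit_lt, Cond.holds]
  | meet i j => simp [foldl_testDigit_meet, Cond.holds]

/-- A full sweep has the effect of the instruction, and lengthens the tape only if needed. -/
theorem sweep_spec (p : Imp R Γ) (ds : List (Digit R)) (L : ℕ) (hL : ds.length ≤ L)
    (hp : ∀ s K, simpleStep s K p = none) (hb : ∀ r, effectRegs (val ds) p r < 2 ^ L) :
    val ((sweep p (initCarry p) ds).1 ++ (overflow (sweep p (initCarry p) ds).2 p).toList) =
      effectRegs (val ds) p ∧
    ((sweep p (initCarry p) ds).1 ++ (overflow (sweep p (initCarry p) ds).2 p).toList).length ≤ L ∧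
    ∀ K, branch K (sweep p (initCarry p) ds).2 p = branch K (testValue (val ds) p) p := by
  cases p with
  | skip | emit _ | seq _ _ | move | loopIn _ => simp [simpleStep] at hp
  | loop t p =>
    rw [sweep_of_digitStep _ (fun d c => testDigit d c t) (fun _ _ => rfl)]
    simp [overflow, effectRegs, initCarry, foldl_testDigit, testValue, hL]
  | ite t p q =>
    rw [sweep_of_digitStep _ (fun d c => testDigit d c t) (fun _ _ => rfl)]
    simp [overflow, effectRegs, initCarry, foldl_testDigit, testValue, hL]
  | assign v i j c =>
    have h1 := sweep_assign (Γ := Γ) v i j c c ds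
    have h2 := fun r => sweep_assign_ne (Γ := Γ) v i j c c ds r
    have h3 := length_sweep (assign v i j c : Imp R Γ) c ds
    have h4 := hb v
    simp only [effectRegs, Function.update_self] at h4
    simp only [initCarry, branch, implies_true, and_true, overflow, effectRegs]
    rw [← h1] at h4
    cases hc : (sweep (assign v i j c : Imp R Γ) c ds).2 with
    | false =>
      rw [hc] at h1
      refine ⟨?_, by simpa [h3] using hL⟩
      ext r
      by_cases hr : r = v
      · subst hr; simpa using h1
      · simp [hr, h2 r hr]
    | true =>
      rw [hc] at h1 h4
      constructor
      · ext r
        rw [val_append, h3]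
        by_cases hr : r = v
        · subst hr; simpa [val] using h1
        · simp [hr, h2 r hr, val]
      · simp only [cond_true, Option.toList_some, List.length_append, h3, List.length_singleton]
        -- With an outgoing carry the new value is at least `2 ^ ds.length`; as it is below `2 ^ L`,
        -- there is room for one more digit.
        simp only [Bool.toNat_true, mul_one] at h4
        exact (Nat.pow_lt_pow_iff_right (by norm_num : 1 < 2)).1 (by omega)

end Imp

namespace Imp

variable {R : ℕ} {Γ : Type}

/-! ### The Turing machine of a register program -/

/-- The control states: the initial state, the state before an instruction, and the states in
which the head moves right over the digits and back to the left end. -/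
inductive Control (S : Type) : Type
  | init
  | rest (K : S)
  | right (K : S) (c : Bool)
  | left (K : S)

instance {S : Type} [Finite S] : Finite (Control S) := by
  refine Finite.of_surjective (α := Unit ⊕ S ⊕ (S × Bool) ⊕ S)
    (fun x => match x with
      | .inl _ => .init
      | .inr (.inl K) => .rest K
      | .inr (.inr (.inl (K, c))) => .right K c
      | .inr (.inr (.inr K)) => .left K) ?_
  rintro (_ | K | ⟨K, c⟩ | K)
  · exact ⟨.inl (), rfl⟩
  · exact ⟨.inr (.inl K), rfl⟩
  · exact ⟨.inr (.inr (.inl (K, c))), rfl⟩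
  · exact ⟨.inr (.inr (.inr K)), rfl⟩

/-- The stacks of a program, as a finite type. -/
abbrev Stack (p : Imp R Γ) : Type := {K : List (Imp R Γ) // K ∈ runStacks p}

instance (p : Imp R Γ) : Finite (Stack p) := (List.finite_toSet (runStacks p)).to_subtype

/-- A list of programs as a stack; the empty stack if it does not occur. -/
def toStack (p : Imp R Γ) (K : List (Imp R Γ)) : Stack p :=
  open Classical in if h : K ∈ runStacks p then ⟨K, h⟩ else ⟨[], List.mem_cons_self⟩

theorem toStack_of_mem {p : Imp R Γ} {K : List (Imp R Γ)} (h : K ∈ runStacks p) :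
    toStack p K = ⟨K, h⟩ := by
  simp [toStack, h]

/-- The symbols of the work tape: the left end marker `none`, blank cells `some none`, and digits. -/
abbrev TapeSymbol (R : ℕ) : Type := Option (Option (Digit R))

/-- The transition function. -/
def machineTrans (p₀ : Imp R Γ) (q : Control (Stack p₀)) (s : Option Bool) (a : TapeSymbol R) :
    Option (Control (Stack p₀) × Move × (TapeSymbol R × Move) × Option Γ) :=
  match q with
  | .init => some (.rest (toStack p₀ [p₀]), .stay, (none, .stay), none)
  | .rest K =>
    match K.1 with
    | [] => none
    | p :: K' =>
      match simpleStep s K' p with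
      | some (K₂, m, o) => some (.rest (toStack p₀ K₂), m, (a, .stay), o)
      | none => some (.right K (initCarry p), .stay, (a, .right), none)
  | .right K c =>
    match K.1, a with
    | [], _ => none
    | _ :: _, none => none
    | p :: _, some (some d) =>
      some (.right K (digitStep p d c).2, .stay, (some (some (digitStep p d c).1), .right), none)
    | p :: K', some none =>
      some (.left (toStack p₀ (branch K' c p)), .stay, (some (overflow c p), .left), none)
  | .left K =>
    match a with
    | none => some (.rest K, .stay, (none, .stay), none)
    | some d => some (.left K, .stay, (some d, .left), none)

/-- The Turing machine that executes a program, with all registers on one work tape. -/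
def machine (p₀ : Imp R Γ) : Machine Γ where
  Q := Control (Stack p₀)
  finite_Q := inferInstance
  A := TapeSymbol R
  finite_A := inferInstance
  tapes := 1
  start := .init
  blank := some none
  trans := fun q s a =>
    (machineTrans p₀ q s (a 0)).map fun (q', m, act, o) => (q', m, fun _ => act, o)

/-- The work tape with given digits. -/
def tape (ds : List (Digit R)) : ℕ → TapeSymbol R
  | 0 => none
  | k + 1 => some ds[k]?

theorem tape_update_digit (pre : List (Digit R)) (d d' : Digit R) (ds : List (Digit R)) :
    Function.update (tape (pre ++ d :: ds)) (pre.length + 1) (some (some d')) =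
      tape (pre ++ [d'] ++ ds) := by
  funext k
  cases k with
  | zero => simp [tape]
  | succ k =>
    by_cases h : k = pre.length
    · subst h; simp [tape]
    · rw [Function.update_of_ne (by omega)]
      simp only [tape, List.append_assoc, List.singleton_append]
      rcases lt_or_ge k pre.length with h' | h'
      · simp [List.getElem?_append_left h']
      · obtain ⟨j, rfl⟩ : ∃ j, k = pre.length + (j + 1) := ⟨k - pre.length - 1, by omega⟩
        rw [List.getElem?_append_right (by omega), List.getElem?_append_right (by omega)]
        simp

theorem tape_update_blank (ds : List (Digit R)) (o : Option (Digit R)) :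
    Function.update (tape ds) (ds.length + 1) (some o) = tape (ds ++ o.toList) := by
  funext k
  cases k with
  | zero => simp [tape]
  | succ k =>
    by_cases h : k = ds.length
    · subst h
      cases o <;> simp [tape]
    · rw [Function.update_of_ne (by omega)]
      simp only [tape]
      rcases lt_or_ge k ds.length with h' | h'
      · simp [List.getElem?_append_left h']
      · rw [List.getElem?_eq_none (by omega), List.getElem?_eq_none]
        cases o <;> simp <;> omega

/-- A configuration of the machine. -/
def mkConfig (p₀ : Imp R Γ) (q : Control (Stack p₀)) (pos : ℕ) (t : ℕ → TapeSymbol R) (h : ℕ)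
    (o : List Γ) : (machine p₀).Config where
  state := q
  inPos := pos
  work := fun _ => t
  head := fun _ => h
  out := o

theorem next_mkConfig {p₀ : Imp R Γ} {w : List Bool} {q q' : Control (Stack p₀)} {pos : ℕ}
    {t : ℕ → TapeSymbol R} {h : ℕ} {o : List Γ} {m mh : Move} {a : TapeSymbol R} {e : Option Γ}
    (ht : machineTrans p₀ q (Machine.inputSymbol w pos) (t h) = some (q', m, (a, mh), e)) :
    (machine p₀).next w (mkConfig p₀ q pos t h o) =
      some (mkConfig p₀ q' (min (m.pos pos) (w.length + 1)) (Function.update t h a) (mh.pos h)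
        (o ++ e.toList)) := by
  simp [Machine.next, machine, mkConfig, ht]

theorem next_mkConfig_none {p₀ : Imp R Γ} {w : List Bool} {q : Control (Stack p₀)} {pos : ℕ}
    {t : ℕ → TapeSymbol R} {h : ℕ} {o : List Γ}
    (ht : machineTrans p₀ q (Machine.inputSymbol w pos) (t h) = none) :
    (machine p₀).next w (mkConfig p₀ q pos t h o) = none := by
  simp [Machine.next, machine, mkConfig, ht]

end Imp

/-! ### Bounded runs of the machine -/

/-- A step from a configuration whose work heads are in the cells `0, …, H`. -/
def Machine.BoundedStep {Γ : Type} (M : Machine Γ) (w : List Bool) (H : ℕ) (a b : M.Config) :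
    Prop :=
  M.next w a = some b ∧ ∀ i, a.head i ≤ H

/-- If a halting configuration is reached by bounded steps, then all configurations of the run are
bounded. -/
theorem Machine.head_le_of_boundedStep {Γ : Type} {M : Machine Γ} {w : List Bool} {H : ℕ}
    {a z : M.Config} (h : Relation.ReflTransGen (M.BoundedStep w H) a z) (hz : M.next w z = none)
    (hzH : ∀ i, z.head i ≤ H) {c : M.Config} (hc : StateTransition.Reaches (M.next w) a c) :
    ∀ i, c.head i ≤ H := by
  -- The machine is deterministic, so every reachable configuration lies on the one path to the
  -- halting configuration.
  induction h using Relation.ReflTransGen.head_induction_on with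
  | refl =>
    rcases Relation.ReflTransGen.cases_head hc with rfl | ⟨b, hb, -⟩
    · exact hzH
    · rw [hz] at hb
      simp at hb
  | head hab _ ih =>
    rcases Relation.ReflTransGen.cases_head hc with rfl | ⟨b, hb, hbc⟩
    · exact hab.2
    · rw [hab.1, Option.mem_some_iff] at hb
      subst hb
      exact ih hbc

theorem Machine.reaches_of_boundedStep {Γ : Type} {M : Machine Γ} {w : List Bool} {H : ℕ}
    {a z : M.Config} (h : Relation.ReflTransGen (M.BoundedStep w H) a z) :
    StateTransition.Reaches (M.next w) a z :=
  by
  refine Relation.ReflTransGen.mono (fun x y hab => ?_) _ _ h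
  exact Option.mem_def.2 hab.1

namespace Imp

variable {R : ℕ} {Γ : Type}

-- One pass over the digits `ds`, where `pre` has already been processed. Head position `L + 1` is
-- allowed because a pass ends on the blank cell behind at most `L` digits.
open Relation in
theorem machine_right {p₀ : Imp R Γ} {w : List Bool} {L pos : ℕ} {o : List Γ} {K : Stack p₀}
    {p : Imp R Γ} {K' : List (Imp R Γ)} (hK : K.1 = p :: K') (hpos : pos ≤ w.length + 1)
    (ds : List (Digit R)) : ∀ (pre : List (Digit R)) (c : Bool), pre.length + ds.length ≤ L →
    ReflTransGen ((machine p₀).BoundedStep w (L + 1))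
      (mkConfig p₀ (.right K c) pos (tape (pre ++ ds)) (pre.length + 1) o)
      (mkConfig p₀ (.right K (sweep p c ds).2) pos (tape (pre ++ (sweep p c ds).1))
        (pre.length + ds.length + 1) o) := by
  induction ds with
  | nil => intro pre c _; simpa [sweep] using ReflTransGen.refl
  | cons d ds ih =>
    intro pre c hL
    rw [List.length_cons] at hL
    refine ReflTransGen.head (b := mkConfig p₀ (.right K (digitStep p d c).2) pos
      (tape (pre ++ [(digitStep p d c).1] ++ ds)) (pre.length + 1 + 1) o) ⟨?_, ?_⟩ ?_
    · rw [next_mkConfig (q' := .right K (digitStep p d c).2) (m := .stay) (mh := .right)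
        (a := some (some (digitStep p d c).1)) (e := none), tape_update_digit]
      · simp [Move.pos, hpos]
      · simp [machineTrans, hK, tape]
    · intro i
      simp only [mkConfig]
      omega
    · have h := ih (pre ++ [(digitStep p d c).1]) (digitStep p d c).2 (by simp; omega)
      simp only [List.length_append, List.length_singleton] at h
      have e : pre.length + (d :: ds).length + 1 = pre.length + 1 + ds.length + 1 := by
        rw [List.length_cons]; ring
      rw [e]
      simpa [sweep] using h

-- Only cell `0` carries the symbol `none`, so the head recognises the left end.
open Relation in
theorem machine_left {p₀ : Imp R Γ} {w : List Bool} {L pos : ℕ} {o : List Γ} {K : Stack p₀}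
    (hpos : pos ≤ w.length + 1) (ds : List (Digit R)) (h : ℕ) (hL : h ≤ L) :
    ReflTransGen ((machine p₀).BoundedStep w L)
      (mkConfig p₀ (.left K) pos (tape ds) h o) (mkConfig p₀ (.rest K) pos (tape ds) 0 o) := by
  induction h with
  | zero =>
    refine ReflTransGen.single ⟨?_, fun i => by simp [mkConfig]⟩
    rw [next_mkConfig (q' := .rest K) (m := .stay) (mh := .stay) (a := none) (e := none)]
    · have : Function.update (tape ds) 0 none = tape ds := Function.update_eq_self 0 (tape ds)
      simp [Move.pos, hpos, this]
    · simp [machineTrans, tape]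
  | succ h ih =>
    refine ReflTransGen.head ⟨?_, fun i => by simpa [mkConfig] using hL⟩ (ih (by omega))
    rw [next_mkConfig (q' := .left K) (m := .stay) (mh := .left) (a := tape ds (h + 1)) (e := none),
      Function.update_eq_self]
    · simp [Move.pos, hpos]
    · simp [machineTrans, tape]

/-- The machine executes a step of the program by bounded steps. -/
theorem machine_step {p₀ : Imp R Γ} {w : List Bool} {L : ℕ} {c c' : ImpConfig R Γ}
    (hs : Imp.next w c = some c') (hK : c.stack ∈ runStacks p₀) (hpos : c.pos ≤ w.length + 1)
    (hb : ∀ r, c'.regs r < 2 ^ L) (ds : List (Digit R)) (hds : val ds = c.regs)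
    (hL : ds.length ≤ L) :
    ∃ (hK' : c'.stack ∈ runStacks p₀) (ds' : List (Digit R)), val ds' = c'.regs ∧ ds'.length ≤ L ∧
      c'.pos ≤ w.length + 1 ∧
      Relation.ReflTransGen ((machine p₀).BoundedStep w (L + 1))
        (mkConfig p₀ (.rest ⟨c.stack, hK⟩) c.pos (tape ds) 0 c.out)
        (mkConfig p₀ (.rest ⟨c'.stack, hK'⟩) c'.pos (tape ds') 0 c'.out) := by
  obtain ⟨K, pos, σ, o⟩ := c
  simp only at hK hpos hds
  subst hds
  cases K with
  | nil => simp [Imp.next] at hs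
  | cons p K =>
    have hcl := runStacks_closed hK
    cases hsimp : simpleStep (Machine.inputSymbol w pos) K p with
    | some x =>
      obtain ⟨K₂, m, e⟩ := x
      simp only [Imp.next, hsimp, Option.some.injEq] at hs
      subst hs
      have hK₂ := hcl.1 _ _ _ _ hsimp
      refine ⟨hK₂, ds, rfl, hL, min_le_right _ _, .single ⟨?_, fun i => by simp [mkConfig]⟩⟩
      rw [next_mkConfig (q' := .rest ⟨K₂, hK₂⟩) (m := m) (mh := .stay) (a := tape ds 0) (e := e),
        Function.update_eq_self]
      · simp [Move.pos]
      · simp [machineTrans, hsimp, toStack_of_mem hK₂]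
    | none =>
      -- Whether an instruction needs a sweep depends only on its form, not on the input symbol or
      -- the stack.
      have hnone : ∀ s K, simpleStep s K p = none := by
        cases p <;> simp_all [simpleStep]
      simp only [Imp.next, hsimp, Option.some.injEq] at hs
      subst hs
      obtain ⟨h1, h2, h3⟩ := sweep_spec p ds L hL hnone hb
      have hK₂ := hcl.2 _ (testValue (val ds) p) hsimp
      have hlen := length_sweep p (initCarry p) ds
      refine ⟨hK₂, _, h1, h2, hpos, ?_⟩
      refine .head (b := mkConfig p₀ (.right ⟨p :: K, hK⟩ (initCarry p)) pos (tape ([] ++ ds)) 1 o)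
        ⟨?_, fun i => by simp [mkConfig]⟩ ?_
      · rw [next_mkConfig (q' := .right ⟨p :: K, hK⟩ (initCarry p)) (m := .stay) (mh := .right)
          (a := tape ds 0) (e := none), Function.update_eq_self]
        · simp [Move.pos, hpos]
        · simp [machineTrans, hsimp]
      refine (machine_right rfl hpos ds [] (initCarry p) (by simpa using hL)).trans ?_
      refine .head (b := mkConfig p₀ (.left ⟨_, hK₂⟩) pos (tape _) ds.length o)
        ⟨?_, fun i => by simp [mkConfig, hL]⟩ (machine_left hpos _ _ (by omega))
      rw [next_mkConfig (q' := .left ⟨_, hK₂⟩) (m := .stay) (mh := .left)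
          (a := some (overflow (sweep p (initCarry p) ds).2 p)) (e := none)]
      · rw [List.length_nil, Nat.zero_add, List.nil_append, ← hlen, tape_update_blank]
        simp [Move.pos, hpos]
      · have : tape ([] ++ (sweep p (initCarry p) ds).1) (([] : List (Digit R)).length + ds.length + 1) =
            some none := by
          simp [tape, hlen]
        rw [this]
        have h3' := h3 K
        simp [machineTrans, h3', toStack_of_mem hK₂]

/-- A step of the program to a configuration with registers below `B`. -/
def BoundedStep (w : List Bool) (B : ℕ) (c c' : ImpConfig R Γ) : Prop :=
  Imp.next w c = some c' ∧ ∀ r, c'.regs r < B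

theorem machine_run {p₀ : Imp R Γ} {w : List Bool} {L : ℕ} {c c' : ImpConfig R Γ}
    (h : Relation.ReflTransGen (BoundedStep w (2 ^ L)) c c') (hK : c.stack ∈ runStacks p₀)
    (hpos : c.pos ≤ w.length + 1) (ds : List (Digit R)) (hds : val ds = c.regs)
    (hL : ds.length ≤ L) :
    ∃ (hK' : c'.stack ∈ runStacks p₀) (ds' : List (Digit R)), val ds' = c'.regs ∧ ds'.length ≤ L ∧
      c'.pos ≤ w.length + 1 ∧
      Relation.ReflTransGen ((machine p₀).BoundedStep w (L + 1))
        (mkConfig p₀ (.rest ⟨c.stack, hK⟩) c.pos (tape ds) 0 c.out)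
        (mkConfig p₀ (.rest ⟨c'.stack, hK'⟩) c'.pos (tape ds') 0 c'.out) := by
  induction h with
  | refl => exact ⟨hK, ds, hds, hL, hpos, .refl⟩
  | tail _ hbc ih =>
    obtain ⟨hK₁, ds₁, h1, h2, h3, h4⟩ := ih
    obtain ⟨hK₂, ds₂, k1, k2, k3, k4⟩ := machine_step hbc.1 hK₁ h3 hbc.2 ds₁ h1 h2
    exact ⟨hK₂, ds₂, k1, k2, k3, h4.trans k4⟩

theorem init_eq (p₀ : Imp R Γ) :
    (machine p₀).init = mkConfig p₀ .init 0 (fun _ => some none) 0 [] := rfl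

/-- Words that are generated by a program with polynomially bounded registers are generated in
logarithmic space. -/
theorem logSpaceGenerated {f : ℕ → ℕ → List Γ} (p₀ : Imp R Γ) (k : ℕ)
    (h : ∀ n t, ∃ pos σ, Relation.ReflTransGen
      (BoundedStep (unaryPair n t) (2 ^ (k * Nat.log 2 ((unaryPair n t).length + 2))))
      ⟨[p₀], 0, fun _ => 0, []⟩ ⟨[], pos, σ, f n t⟩) : LogSpaceGenerated f := by
  -- Heads stay within `L + 1` cells; the additional `1` is absorbed by raising `k` to `k + 1`, as
  -- the logarithm is at least one.
  refine ⟨machine p₀, k + 1, fun n t => ?_⟩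
  obtain ⟨pos, σ, hrun⟩ := h n t
  set w := unaryPair n t
  set L := k * Nat.log 2 (w.length + 2)
  have hlog : 1 ≤ Nat.log 2 (w.length + 2) := Nat.log_pos (by norm_num) (by omega)
  have hK : [p₀] ∈ runStacks p₀ := List.mem_cons_of_mem _ (mem_reach_self p₀ [])
  obtain ⟨hK', ds', -, -, -, hM⟩ := machine_run hrun hK (Nat.zero_le _) [] rfl (Nat.zero_le _)
  have hM' : Relation.ReflTransGen ((machine p₀).BoundedStep w (L + 1)) (machine p₀).init
      (mkConfig p₀ (.rest ⟨[], hK'⟩) pos (tape ds') 0 (f n t)) := by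
    refine .head ⟨?_, fun i => by simp [init_eq, mkConfig]⟩ hM
    rw [init_eq, next_mkConfig (q' := .rest ⟨[p₀], hK⟩) (m := .stay) (mh := .stay) (a := none)
      (e := none)]
    · have : Function.update (fun _ => some none) 0 none = tape ([] : List (Digit R)) := by
        funext k
        cases k <;> simp [tape]
      simp [Move.pos, this]
    · simp [machineTrans, toStack_of_mem hK]
  have hhalt : (machine p₀).next w (mkConfig p₀ (.rest ⟨[], hK'⟩) pos (tape ds') 0 (f n t)) = none :=
    next_mkConfig_none (by simp [machineTrans])
  refine ⟨⟨_, Machine.reaches_of_boundedStep hM', hhalt, rfl⟩, fun c hc i => ?_⟩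
  refine (Machine.head_le_of_boundedStep hM' hhalt (fun i => by simp [mkConfig]) hc i).trans ?_
  rw [add_mul, one_mul]
  omega

end Imp

/-! ### Generating programs with scoped registers -/

/-- Programs that generate words, with lexically scoped registers: `forLt v r p` runs `p` for
`v = 0, …, r - 1`; `letAdd v i j c p` runs `p` with `v = i + j + c`; `letPow v u r p` runs `p` with
`u = r` and `v = 2 ^ u`; and `letClog v u r p` runs `p` with `u` the ceiling of the binary logarithm
of `r` and `v = 2 ^ u`. -/
inductive Gen (R : ℕ) (Γ : Type) : Type
  | nil
  | emit (s : Γ)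
  | seq (p q : Gen R Γ)
  | forLt (v r : Fin R) (p : Gen R Γ)
  | ite (c : Cond R) (p q : Gen R Γ)
  | letAdd (v : Fin R) (i j : Option (Fin R)) (c : Bool) (p : Gen R Γ)
  | letPow (v u r : Fin R) (p : Gen R Γ)
  | letClog (v u r : Fin R) (p : Gen R Γ)

/-- The registers of a test are below `d`. -/
def Cond.WF {R : ℕ} (d : ℕ) : Cond R → Bool
  | lt i j => i.1 < d && j.1 < d
  | meet i j => i.1 < d && j.1 < d

namespace Gen

variable {R : ℕ} {Γ : Type}

/-- The generated word, where `ρ` are the values of the registers. -/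
def eval : Gen R Γ → (Fin R → ℕ) → List Γ
  | nil, _ => []
  | emit s, _ => [s]
  | seq p q, ρ => eval p ρ ++ eval q ρ
  | forLt v r p, ρ => (List.range (ρ r)).flatMap fun i => eval p (Function.update ρ v i)
  | ite c p q, ρ => bif c.holds ρ then eval p ρ else eval q ρ
  | letAdd v i j c p, ρ => eval p (Function.update ρ v (operand ρ i + operand ρ j + c.toNat))
  | letPow v u r p, ρ => eval p (Function.update (Function.update ρ v (2 ^ ρ r)) u (ρ r))
  | letClog v u r p, ρ =>
    eval p (Function.update (Function.update ρ v (2 ^ Nat.clog 2 (ρ r))) u (Nat.clog 2 (ρ r)))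

/-- The values of all bound registers are below `B`. -/
def Bounded (B : ℕ) : Gen R Γ → (Fin R → ℕ) → Prop
  | nil, _ => True
  | emit _, _ => True
  | seq p q, ρ => Bounded B p ρ ∧ Bounded B q ρ
  | forLt v r p, ρ => ∀ i < ρ r, Bounded B p (Function.update ρ v i)
  | ite _ p q, ρ => Bounded B p ρ ∧ Bounded B q ρ
  | letAdd v i j c p, ρ => operand ρ i + operand ρ j + c.toNat < B ∧
    Bounded B p (Function.update ρ v (operand ρ i + operand ρ j + c.toNat))
  | letPow v u r p, ρ => 2 ^ ρ r < B ∧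
    Bounded B p (Function.update (Function.update ρ v (2 ^ ρ r)) u (ρ r))
  | letClog v u r p, ρ => 2 ^ Nat.clog 2 (ρ r) < B ∧
    Bounded B p
      (Function.update (Function.update ρ v (2 ^ Nat.clog 2 (ρ r))) u (Nat.clog 2 (ρ r)))

/-- The registers are bound in the order of their numbers, beginning with `d`, before they are
read. -/
def WF : ℕ → Gen R Γ → Bool
  | _, nil => true
  | _, emit _ => true
  | d, seq p q => WF d p && WF d q
  | d, forLt v r p => r.1 < d && v.1 == d && WF (d + 1) p
  | d, ite c p q => c.WF d && WF d p && WF d q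
  | d, letAdd v i j _ p => i.all (·.1 < d) && j.all (·.1 < d) && v.1 == d && WF (d + 1) p
  | d, letPow v u r p => r.1 < d && v.1 == d && u.1 == d + 1 && WF (d + 2) p
  | d, letClog v u r p => r.1 < d && v.1 == d && u.1 == d + 1 && WF (d + 2) p

/-- The loop body that doubles `v` and increments `u`. -/
def doubling (v u : Fin R) : Imp R Γ :=
  .seq (.assign v (some v) (some v) false) (.assign u (some u) none true)

/-- The register program for a generating program. -/
def compile : Gen R Γ → Imp R Γ
  | nil => .skip
  | emit s => .emit s
  | seq p q => .seq (compile p) (compile q)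
  | forLt v r p => .seq (.assign v none none false)
      (.loop (.lt v r) (.seq (compile p) (.assign v (some v) none true)))
  | ite c p q => .ite c (compile p) (compile q)
  | letAdd v i j c p => .seq (.assign v i j c) (compile p)
  | letPow v u r p => .seq (.assign v none none true) (.seq (.assign u none none false)
      (.seq (.loop (.lt u r) (doubling v u)) (compile p)))
  | letClog v u r p => .seq (.assign v none none true) (.seq (.assign u none none false)
      (.seq (.loop (.lt v r) (doubling v u)) (compile p)))

end Gen

/-! ### Runs of single instructions and of the doubling loop -/

namespace Imp

variable {R : ℕ} {Γ : Type} {w : List Bool} {B : ℕ}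

/-- Bounded runs of register programs. -/
abbrev Run (w : List Bool) (B : ℕ) : ImpConfig R Γ → ImpConfig R Γ → Prop :=
  Relation.ReflTransGen (BoundedStep w B)

variable {K : List (Imp R Γ)} {pos : ℕ} {σ : Fin R → ℕ} {o : List Γ}

theorem run_skip (hpos : pos ≤ w.length + 1) (hσ : ∀ r, σ r < B) :
    Run w B ⟨skip :: K, pos, σ, o⟩ ⟨K, pos, σ, o⟩ :=
  .single ⟨by simp [Imp.next, simpleStep, Move.pos, hpos], hσ⟩

theorem run_emit (hpos : pos ≤ w.length + 1) (hσ : ∀ r, σ r < B) (s : Γ) :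
    Run w B ⟨emit s :: K, pos, σ, o⟩ ⟨K, pos, σ, o ++ [s]⟩ :=
  .single ⟨by simp [Imp.next, simpleStep, Move.pos, hpos], hσ⟩

theorem run_seq (hpos : pos ≤ w.length + 1) (hσ : ∀ r, σ r < B) (p q : Imp R Γ) :
    Run w B ⟨seq p q :: K, pos, σ, o⟩ ⟨p :: q :: K, pos, σ, o⟩ :=
  .single ⟨by simp [Imp.next, simpleStep, Move.pos, hpos], hσ⟩

theorem update_lt (hσ : ∀ r, σ r < B) {v : Fin R} {x : ℕ} (hx : x < B) (r : Fin R) :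
    Function.update σ v x r < B := by
  by_cases h : r = v
  · subst h; simpa using hx
  · simpa [h] using hσ r

theorem run_assign (hσ : ∀ r, σ r < B) (v : Fin R) (i j : Option (Fin R)) (c : Bool)
    (hx : operand σ i + operand σ j + c.toNat < B) :
    Run w B ⟨assign v i j c :: K, pos, σ, o⟩
      ⟨K, pos, Function.update σ v (operand σ i + operand σ j + c.toNat), o⟩ :=
  .single ⟨by simp [Imp.next, simpleStep, effectRegs, branch], update_lt hσ hx⟩

theorem run_loop (hσ : ∀ r, σ r < B) (c : Cond R) (p : Imp R Γ) :
    Run w B ⟨loop c p :: K, pos, σ, o⟩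
      ⟨if c.holds σ then p :: loop c p :: K else K, pos, σ, o⟩ :=
  .single ⟨by cases h : c.holds σ <;> simp [Imp.next, simpleStep, effectRegs, branch, testValue, h], hσ⟩

theorem run_ite (hσ : ∀ r, σ r < B) (c : Cond R) (p q : Imp R Γ) :
    Run w B ⟨ite c p q :: K, pos, σ, o⟩
      ⟨if c.holds σ then p :: K else q :: K, pos, σ, o⟩ :=
  .single ⟨by cases h : c.holds σ <;> simp [Imp.next, simpleStep, effectRegs, branch, testValue, h], hσ⟩

theorem run_move (hσ : ∀ r, σ r < B) :
    Run w B ⟨move :: K, pos, σ, o⟩ ⟨K, min (pos + 1) (w.length + 1), σ, o⟩ :=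
  .single ⟨by simp [Imp.next, simpleStep, Move.pos], hσ⟩

theorem run_loopIn (hpos : pos ≤ w.length + 1) (hσ : ∀ r, σ r < B) (p : Imp R Γ) :
    Run w B ⟨loopIn p :: K, pos, σ, o⟩
      ⟨if Machine.inputSymbol w pos = some true then p :: loopIn p :: K else K, pos, σ, o⟩ :=
  .single ⟨by simp [Imp.next, simpleStep, Move.pos, hpos], hσ⟩

/-- The doubling loop: after `k` rounds that satisfy the test. -/
theorem run_doubling (hpos : pos ≤ w.length + 1) (hσ : ∀ r, σ r < B) {v u : Fin R} (huv : v ≠ u)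
    (c : Cond R) (k : ℕ) (hk : 2 ^ k < B) (hv : σ v = 1) (hu : σ u = 0)
    (hc : ∀ j < k, c.holds (Function.update (Function.update σ v (2 ^ j)) u j)) :
    Run w B ⟨loop c (Gen.doubling v u) :: K, pos, σ, o⟩
      ⟨loop c (Gen.doubling v u) :: K, pos, Function.update (Function.update σ v (2 ^ k)) u k, o⟩ := by
  induction k with
  | zero =>
    have e : Function.update (Function.update σ v (2 ^ 0)) u 0 = σ := by
      rw [pow_zero, ← hv, Function.update_eq_self, ← hu, Function.update_eq_self]
    rw [e]
  | succ k ih =>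
    have hkB : 2 ^ k < B := lt_of_le_of_lt (Nat.pow_le_pow_right (by norm_num) (Nat.le_succ k)) hk
    have hlt : k + 1 < B := lt_trans Nat.lt_two_pow_self hk
    refine (ih hkB fun j hj => hc j (by omega)).trans ?_
    have h1 : ∀ r, Function.update (Function.update σ v (2 ^ k)) u k r < B :=
      update_lt (update_lt hσ hkB) (by omega)
    refine (run_loop h1 _ _).trans ?_
    rw [if_pos (hc k (by omega))]
    refine (run_seq hpos h1 _ _).trans ?_
    set τ := Function.update (Function.update σ v (2 ^ k)) u k with hτ
    have hτv : τ v = 2 ^ k := by simp [hτ, huv]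
    have hτu : τ u = k := by simp [hτ]
    have e1 : operand τ (some v) + operand τ (some v) + false.toNat = 2 ^ (k + 1) := by
      simp only [operand, Option.elim_some, hτv, Bool.toNat_false]; ring
    refine (run_assign h1 _ _ _ _ (by rw [e1]; exact hk)).trans ?_
    rw [e1]
    have h2 : ∀ r, Function.update τ v (2 ^ (k + 1)) r < B := update_lt h1 hk
    have e2 : operand (Function.update τ v (2 ^ (k + 1))) (some u) +
        operand (Function.update τ v (2 ^ (k + 1))) none + true.toNat = k + 1 := by
      simp [operand, huv.symm, hτu]
    refine (run_assign h2 _ _ _ _ (by rw [e2]; exact hlt)).trans ?_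
    have e3 : Function.update (Function.update τ v (2 ^ (k + 1))) u (k + 1) =
        Function.update (Function.update σ v (2 ^ (k + 1))) u (k + 1) := by
      ext r
      by_cases hr : r = u
      · subst hr; simp
      · by_cases hr' : r = v
        · subst hr'; simp [hr]
        · simp [hτ, hr, hr']
    rw [e2, e3]

end Imp

/-! ### Correctness of the compilation -/

namespace Gen

variable {R : ℕ} {Γ : Type} {w : List Bool} {B : ℕ}

/-- The registers below `d` have the same values. -/
def Agree (d : ℕ) (σ ρ : Fin R → ℕ) : Prop := ∀ r : Fin R, r.1 < d → σ r = ρ r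

theorem Agree.update {d : ℕ} {σ ρ : Fin R → ℕ} (h : Agree d σ ρ) {v : Fin R} (hv : v.1 = d)
    (x : ℕ) : Agree (d + 1) (Function.update σ v x) (Function.update ρ v x) := by
  intro r hr
  by_cases e : r = v
  · subst e; simp
  · have : r.1 ≠ v.1 := fun h => e (Fin.ext h)
    simp [e, h r (by omega)]

/-- Registers from `d` on are scratch space at depth `d`. -/
theorem Agree.update_left {d : ℕ} {σ ρ : Fin R → ℕ} (h : Agree d σ ρ) {v : Fin R} (hv : d ≤ v.1)
    (x : ℕ) : Agree d (Function.update σ v x) ρ := by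
  intro r hr
  have : r ≠ v := fun e => by subst e; omega
  simp [this, h r hr]

/-- Leaving the scope of `v`: its value is forgotten. -/
theorem Agree.update_right {d : ℕ} {σ ρ : Fin R → ℕ} {v : Fin R} {x : ℕ}
    (h : Agree (d + 1) σ (Function.update ρ v x)) (hv : v.1 = d) : Agree d σ ρ := by
  intro r hr
  have : r ≠ v := fun e => by subst e; omega
  simpa [this] using h r (by omega)

theorem Agree.holds {d : ℕ} {σ ρ : Fin R → ℕ} (h : Agree d σ ρ) {c : Cond R} (hc : c.WF d) :
    c.holds σ = c.holds ρ := by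
  cases c with
  | lt i j | meet i j =>
    simp only [Cond.WF, Bool.and_eq_true, decide_eq_true_eq] at hc
    simp only [Cond.holds, h i hc.1, h j hc.2]

theorem Agree.operand {d : ℕ} {σ ρ : Fin R → ℕ} (h : Agree d σ ρ) {i : Option (Fin R)}
    (hi : i.all (·.1 < d)) : operand σ i = operand ρ i := by
  cases i with
  | none => rfl
  | some i => exact h i (by simpa using hi)

/-- The compiled program generates the word. -/
theorem compile_run (g : Gen R Γ) : ∀ (d : ℕ) (ρ σ : Fin R → ℕ) (K : List (Imp R Γ)) (pos : ℕ)
    (o : List Γ), g.WF d → g.Bounded B ρ → Agree d σ ρ → (∀ r, σ r < B) → pos ≤ w.length + 1 →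
    ∃ σ', Agree d σ' ρ ∧ (∀ r, σ' r < B) ∧
      Imp.Run w B ⟨g.compile :: K, pos, σ, o⟩ ⟨K, pos, σ', o ++ g.eval ρ⟩ := by
  induction g with
  | nil =>
    intro d ρ σ K pos o hwf hb hag hσ hpos
    exact ⟨σ, hag, hσ, by simpa [eval, compile] using Imp.run_skip hpos hσ⟩
  | emit s =>
    intro d ρ σ K pos o hwf hb hag hσ hpos
    exact ⟨σ, hag, hσ, by simpa [eval, compile] using Imp.run_emit hpos hσ s⟩
  | seq p q ihp ihq =>
    intro d ρ σ K pos o hwf hb hag hσ hpos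
    simp only [WF, Bool.and_eq_true] at hwf
    obtain ⟨σ₁, a1, b1, r1⟩ := ihp d ρ σ (q.compile :: K) pos o hwf.1 hb.1 hag hσ hpos
    obtain ⟨σ₂, a2, b2, r2⟩ := ihq d ρ σ₁ K pos (o ++ p.eval ρ) hwf.2 hb.2 a1 b1 hpos
    refine ⟨σ₂, a2, b2, (Imp.run_seq hpos hσ _ _).trans (r1.trans ?_)⟩
    simpa [eval] using r2
  | ite c p q ihp ihq =>
    intro d ρ σ K pos o hwf hb hag hσ hpos
    simp only [WF, Bool.and_eq_true] at hwf
    have hr := Imp.run_ite (w := w) (K := K) (pos := pos) (o := o) hσ c p.compile q.compile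
    rw [hag.holds hwf.1.1] at hr
    cases hc : c.holds ρ with
    | true =>
      obtain ⟨σ₁, a1, b1, r1⟩ := ihp d ρ σ K pos o hwf.1.2 hb.1 hag hσ hpos
      refine ⟨σ₁, a1, b1, (hr.trans ?_)⟩
      simpa [eval, hc] using r1
    | false =>
      obtain ⟨σ₁, a1, b1, r1⟩ := ihq d ρ σ K pos o hwf.2 hb.2 hag hσ hpos
      refine ⟨σ₁, a1, b1, (hr.trans ?_)⟩
      simpa [eval, hc] using r1
  | letAdd v i j c p ih =>
    intro d ρ σ K pos o hwf hb hag hσ hpos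
    simp only [WF, Bool.and_eq_true, beq_iff_eq] at hwf
    obtain ⟨⟨⟨hi, hj⟩, hv⟩, hp⟩ := hwf
    have e : operand σ i + operand σ j + c.toNat = operand ρ i + operand ρ j + c.toNat := by
      rw [hag.operand hi, hag.operand hj]
    have hr := Imp.run_assign (w := w) (K := p.compile :: K) (pos := pos) (o := o) hσ v i j c
      (by rw [e]; exact hb.1)
    rw [e] at hr
    obtain ⟨σ₁, a1, b1, r1⟩ := ih (d + 1) _ _ K pos o hp hb.2 (hag.update hv _)
      (Imp.update_lt hσ hb.1) hpos
    exact ⟨σ₁, a1.update_right hv, b1, (Imp.run_seq hpos hσ _ _).trans (hr.trans r1)⟩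
  | forLt v r p ih =>
    intro d ρ σ K pos o hwf hb hag hσ hpos
    simp only [WF, Bool.and_eq_true, beq_iff_eq, decide_eq_true_eq] at hwf
    obtain ⟨⟨hr, hv⟩, hp⟩ := hwf
    -- The loop counter never exceeds the outer register `r`, which is why `Bounded` asks nothing of
    -- it.
    have hρr : ρ r < B := hag r hr ▸ hσ r
    set body : Imp R Γ := .seq p.compile (.assign v (some v) none true) with hbody
    have key : ∀ k ≤ ρ r, ∃ σ', Agree d σ' ρ ∧ (∀ r, σ' r < B) ∧ σ' v = k ∧
        Imp.Run w B ⟨(forLt v r p).compile :: K, pos, σ, o⟩ ⟨.loop (.lt v r) body :: K, pos, σ',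
          o ++ (List.range k).flatMap fun i => p.eval (Function.update ρ v i)⟩ := by
      intro k
      induction k with
      | zero =>
        intro _
        refine ⟨Function.update σ v 0, hag.update_left hv.ge 0, Imp.update_lt hσ (by omega),
          by simp, (Imp.run_seq hpos hσ _ _).trans ?_⟩
        simpa [operand] using Imp.run_assign hσ v none none false (by simp [operand]; omega)
      | succ k ihk =>
        intro hk
        obtain ⟨σ₁, a1, b1, e1, r1⟩ := ihk (by omega)
        have hl := Imp.run_loop (w := w) (K := K) (pos := pos)
          (o := o ++ (List.range k).flatMap fun i => p.eval (Function.update ρ v i)) b1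
          (.lt v r) body
        have ht : (Cond.lt v r).holds σ₁ = true := by
          simp only [Cond.holds, e1, a1 r hr, decide_eq_true_eq]; omega
        rw [if_pos ht] at hl
        have a1' : Agree (d + 1) σ₁ (Function.update ρ v k) := by
          have := a1.update hv k
          rwa [← e1, Function.update_eq_self, e1] at this
        obtain ⟨σ₂, a2, b2, r2⟩ := ih (d + 1) _ _ (.assign v (some v) none true ::
          .loop (.lt v r) body :: K) pos (o ++ (List.range k).flatMap fun i =>
            p.eval (Function.update ρ v i)) hp (hb k (by omega)) a1' b1 hpos
        have e2 : operand σ₂ (some v) + operand σ₂ none + true.toNat = k + 1 := by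
          simp [operand, a2 v (by omega)]
        have ha := Imp.run_assign (w := w) (K := .loop (.lt v r) body :: K) (pos := pos)
          (o := (o ++ (List.range k).flatMap fun i => p.eval (Function.update ρ v i)) ++
            p.eval (Function.update ρ v k)) b2 v (some v) none true (by rw [e2]; omega)
        rw [e2] at ha
        refine ⟨Function.update σ₂ v (k + 1), (a2.update_right hv).update_left hv.ge _,
          Imp.update_lt b2 (by omega), by simp, ?_⟩
        rw [List.range_succ, List.flatMap_append, ← List.append_assoc]
        simpa using r1.trans (hl.trans ((Imp.run_seq hpos b1 _ _).trans (r2.trans ha)))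
    obtain ⟨σ', a, b, e, h⟩ := key (ρ r) le_rfl
    refine ⟨σ', a, b, h.trans ?_⟩
    have hl := Imp.run_loop (w := w) (K := K) (pos := pos)
      (o := o ++ (List.range (ρ r)).flatMap fun i => p.eval (Function.update ρ v i)) b
      (.lt v r) body
    have ht : ¬ (Cond.lt v r).holds σ' = true := by
      simp [Cond.holds, e, a r hr]
    rw [if_neg ht] at hl
    exact hl
  | letPow v u r p ih | letClog v u r p ih =>
    intro d ρ σ K pos o hwf hb hag hσ hpos
    simp only [WF, Bool.and_eq_true, beq_iff_eq, decide_eq_true_eq] at hwf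
    obtain ⟨⟨⟨hr, hv⟩, hu⟩, hp⟩ := hwf
    obtain ⟨hb1, hb2⟩ := hb
    have hvu : v ≠ u := fun e => by rw [e] at hv; omega
    have hrv : r ≠ v := fun e => by rw [e] at hr; omega
    have hru : r ≠ u := fun e => by rw [e] at hr; omega
    have h1B : 1 < B := lt_of_le_of_lt Nat.one_le_two_pow hb1
    have hs1 := Imp.update_lt (v := v) hσ h1B
    have hs2 := Imp.update_lt (v := u) hs1 (by omega : 0 < B)
    -- `letPow` and `letClog` are the same doubling loop with different tests `c`; what matters is
    -- that `c` holds in rounds `j < k` and fails at `k`.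
    refine (?_ : ∀ k, ∀ c : Cond R, 2 ^ k < B →
      (∀ j < k, c.holds (Function.update (Function.update σ v (2 ^ j)) u j)) →
      ¬ c.holds (Function.update (Function.update σ v (2 ^ k)) u k) →
      p.Bounded B (Function.update (Function.update ρ v (2 ^ k)) u k) →
      ∃ σ', Agree d σ' ρ ∧ (∀ r, σ' r < B) ∧ Imp.Run w B
        ⟨.seq (.assign v none none true) (.seq (.assign u none none false)
          (.seq (.loop c (doubling v u)) (compile p))) :: K, pos, σ, o⟩
        ⟨K, pos, σ', o ++ p.eval (Function.update (Function.update ρ v (2 ^ k)) u k)⟩)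
      _ _ hb1 ?_ ?_ hb2
    · intro k c hk hc1 hc2 hpb
      have hs3 := Imp.update_lt (v := v) hσ hk
      have hs4 := Imp.update_lt (v := u) hs3 (lt_trans Nat.lt_two_pow_self hk)
      obtain ⟨σ₁, a1, b1, r1⟩ := ih (d + 2) _ _ K pos o hp hpb
        ((hag.update hv (2 ^ k)).update hu k) hs4 hpos
      refine ⟨σ₁, (a1.update_right hu).update_right hv, b1, ?_⟩
      refine (Imp.run_seq hpos hσ _ _).trans ?_
      refine (Imp.run_assign hσ _ _ _ _ (by simpa [operand] using h1B)).trans ?_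
      refine (Imp.run_seq hpos (by simpa [operand] using hs1) _ _).trans ?_
      refine (Imp.run_assign (by simpa [operand] using hs1) _ _ _ _
        (by simp [operand]; omega)).trans ?_
      have e : ∀ τ : Fin R → ℕ, operand τ none = 0 := fun _ => rfl
      simp only [e, Bool.toNat_true, Bool.toNat_false, Nat.zero_add, Nat.add_zero]
      refine (Imp.run_seq hpos hs2 _ _).trans ?_
      refine (Imp.run_doubling hpos hs2 hvu c k hk (by simp [hvu]) (by simp)
        (fun j hj => ?_)).trans ?_
      · rw [Function.update_comm hvu, Function.update_idem, Function.update_comm hvu.symm,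
          Function.update_idem]
        exact hc1 j hj
      rw [Function.update_comm hvu, Function.update_idem, Function.update_comm hvu.symm,
          Function.update_idem]
      refine (Imp.run_loop hs4 _ _).trans ?_
      rw [if_neg hc2]
      exact r1
    · intro j hj
      -- The first alternative serves `letPow`, with test `u < r`; the second serves `letClog`,
      -- where `2 ^ j < r` iff `j < Nat.clog 2 r`.
      first
      | simpa [Cond.holds, hru, hrv, hvu, hag r hr] using hj
      | simpa [Cond.holds, hru, hrv, hvu, hag r hr] using (Nat.lt_clog_iff_pow_lt (by norm_num)).1 hj
    · first
      | simp [Cond.holds, hru, hrv, hag r hr]; done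
      | simpa [Cond.holds, hru, hrv, hvu, hag r hr] using Nat.le_pow_clog (by norm_num) _

end Gen

/-! ### Reading the unary input -/

namespace Imp

variable {R : ℕ} {Γ : Type} {w : List Bool} {B : ℕ}

/-- The loop that adds to `v` the number of consecutive input symbols `true`. -/
def countInput (v : Fin R) : Imp R Γ := .loopIn (.seq (.assign v (some v) none true) .move)

theorem run_countInput (v : Fin R) {K : List (Imp R Γ)} {o : List Γ} (k : ℕ) :
    ∀ (pos : ℕ) (σ : Fin R → ℕ), pos + k ≤ w.length + 1 → (∀ r, σ r < B) → σ v + k < B →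
    (∀ j < k, Machine.inputSymbol w (pos + j) = some true) →
    Machine.inputSymbol w (pos + k) ≠ some true →
    Run w B ⟨countInput v :: K, pos, σ, o⟩
      ⟨K, pos + k, Function.update σ v (σ v + k), o⟩ := by
  induction k with
  | zero =>
    intro pos σ hpos hσ hB _ h
    have := run_loopIn (K := K) (o := o) hpos hσ (.seq (.assign v (some v) none true) .move)
    rw [if_neg h] at this
    simpa [countInput] using this
  | succ k ih =>
    intro pos σ hpos hσ hB h1 h2
    have := run_loopIn (K := K) (o := o) (by omega : pos ≤ w.length + 1) hσ
      (.seq (.assign v (some v) none true) .move)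
    have h0 : Machine.inputSymbol w pos = some true := h1 0 (by omega)
    rw [if_pos h0] at this
    refine this.trans ((run_seq (by omega) hσ _ _).trans ?_)
    refine (run_assign hσ _ _ _ _ (by simp [operand]; omega)).trans ?_
    have e : operand σ (some v) + operand σ none + true.toNat = σ v + 1 := by simp [operand]
    rw [e]
    have hσ' := update_lt (v := v) hσ (by omega : σ v + 1 < B)
    refine (run_move hσ').trans ?_
    rw [min_eq_left (by omega)]
    have := ih (pos + 1) _ (by omega) hσ' (by simp; omega)
      (fun j hj => by rw [add_assoc, add_comm 1 j]; exact h1 (j + 1) (by omega))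
      (by rw [add_assoc, add_comm 1 k]; exact h2)
    simp only [Function.update_self, Function.update_idem] at this
    rw [add_assoc, add_comm 1 k, add_assoc, add_comm 1 k] at this
    exact this

end Imp

namespace Gen

variable {R : ℕ} {Γ : Type}

/-- The registers at the beginning: the input is in the first two registers. -/
def inputRegs (n t : ℕ) : Fin (R + 2) → ℕ :=
  Function.update (Function.update (fun _ => 0) 0 n) 1 t

/-- The register program that reads the input and generates a word. -/
def program (g : Gen (R + 2) Γ) : Imp (R + 2) Γ :=
  .seq .move (.seq (.countInput 0) (.seq .move (.seq (.countInput 1) g.compile)))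

/-- The input word has length `n + t + 1`, so `n + t + 3` is the number whose logarithm bounds the
space. The input is counted into the registers `0` and `1`, which is why the scope begins at `2`. -/
theorem logSpaceGenerated (g : Gen (R + 2) Γ) (hg : g.WF 2) (k : ℕ) (hk : 2 ≤ k)
    (hb : ∀ n t, g.Bounded (2 ^ (k * Nat.log 2 (n + t + 3))) (inputRegs n t)) :
    LogSpaceGenerated fun n t => g.eval (inputRegs n t) := by
  refine Imp.logSpaceGenerated g.program k fun n t => ?_
  have hlen : (unaryPair n t).length = n + t + 1 := by simp [unaryPair]; ring
  have hin1 : ∀ p < n, Machine.inputSymbol (unaryPair n t) (p + 1) = some true := by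
    intro p hp
    simp [Machine.inputSymbol, unaryPair, List.getElem?_append_left, hp]
  have hin2 : Machine.inputSymbol (unaryPair n t) (n + 1) = some false := by
    simp [Machine.inputSymbol, unaryPair]
  have hin3 : ∀ p < t, Machine.inputSymbol (unaryPair n t) (n + 2 + p) = some true := by
    intro p hp
    rw [show n + 2 + p = (n + (p + 1)) + 1 by ring]
    simp [Machine.inputSymbol, unaryPair, hp]
  have hin4 : Machine.inputSymbol (unaryPair n t) (n + 2 + t) = none := by
    rw [show n + 2 + t = (n + t + 1) + 1 by ring, ← hlen]
    simp [Machine.inputSymbol]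
  rw [hlen, show n + t + 1 + 2 = n + t + 3 by ring]
  set w := unaryPair n t
  set B := 2 ^ (k * Nat.log 2 (n + t + 3)) with hB
  have hlog : 1 ≤ Nat.log 2 (n + t + 3) := Nat.log_pos (by norm_num) (by omega)
  -- Here `2 ≤ k` is needed: `n + t + 3` is below `2 ^ (log + 1)`, and `log + 1 ≤ k * log` since the
  -- logarithm is positive.
  have hNB : n + t + 3 < B := by
    refine lt_of_lt_of_le (Nat.lt_pow_succ_log_self (by norm_num : 1 < 2) _) ?_
    refine Nat.pow_le_pow_right (by norm_num) ?_
    nlinarith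
  have hσ₀ : ∀ r : Fin (R + 2), (fun _ => 0 : Fin (R + 2) → ℕ) r < B := fun r => by
    show 0 < B; omega
  have hσ₁ := Imp.update_lt (v := (0 : Fin (R + 2))) hσ₀ (by omega : n < B)
  have hσ₂ := Imp.update_lt (v := (1 : Fin (R + 2))) hσ₁ (by omega : t < B)
  obtain ⟨σ', -, -, hrun⟩ := compile_run (w := w) (B := B) g 2 (inputRegs n t) (inputRegs n t) []
    (n + 2 + t) [] hg (hb n t) (fun _ _ => rfl) hσ₂ (by omega)
  refine ⟨_, _, .trans ?_ hrun⟩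
  refine (Imp.run_seq (by omega) hσ₀ _ _).trans ((Imp.run_move hσ₀).trans ?_)
  rw [min_eq_left (by omega)]
  refine (Imp.run_seq (by omega) hσ₀ _ _).trans ?_
  refine (Imp.run_countInput 0 n _ _ (by omega) hσ₀ (by simp; omega)
    (fun j hj => by rw [show 0 + 1 + j = j + 1 by ring]; exact hin1 j hj)
    (by rw [show 0 + 1 + n = n + 1 by ring, hin2]; simp)).trans ?_
  rw [Nat.zero_add n]
  refine (Imp.run_seq (by omega) hσ₁ _ _).trans ((Imp.run_move hσ₁).trans ?_)
  rw [min_eq_left (by omega)]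
  refine (Imp.run_seq (by omega) hσ₁ _ _).trans ?_
  rw [show 0 + 1 + n + 1 = n + 2 by ring]
  have := Imp.run_countInput (w := w) (K := [g.compile]) (o := []) 1 t (n + 2) _ (by omega) hσ₁
    (by simp; omega) hin3 (by rw [hin4]; simp)
  simpa [inputRegs] using this

end Gen

/-! ### Operators of gate lists -/

section Operators

variable {W : Type}

/-- The product state with the one-qubit states `v`. -/
def prodState [Fintype W] (v : W → Bool → ℂ) : State W := fun b => ∏ i, v i (b i)

/-- A basis state is a product state. -/
theorem single_eq_prodState [Fintype W] (s : W → Bool) :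
    (Pi.single s 1 : State W) = prodState fun i β => if β = s i then 1 else 0 := by
  funext b
  rw [prodState, Finset.prod_ite_zero, Pi.single_apply]
  simp [funext_iff]

variable [DecidableEq W]

/-- The operator of a list of gates; the first gate is applied first. -/
def runGates (L : List (Gate OneQubitGate W)) (ψ : State W) : State W :=
  L.foldl (fun φ g => g.apply φ) ψ

theorem runGates_append (L L' : List (Gate OneQubitGate W)) (ψ : State W) :
    runGates (L ++ L') ψ = runGates L' (runGates L ψ) := by
  simp [runGates]

theorem runGates_cons (g : Gate OneQubitGate W) (L : List (Gate OneQubitGate W)) (ψ : State W) :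
    runGates (g :: L) ψ = runGates L (g.apply ψ) := rfl

/-- The gates multiply the amplitudes by `f`. -/
def IsDiag (L : List (Gate OneQubitGate W)) (f : (W → Bool) → ℂ) : Prop :=
  ∀ ψ b, runGates L ψ b = f b * ψ b

/-- The gates permute the amplitudes by `π`. -/
def IsPerm (L : List (Gate OneQubitGate W)) (π : (W → Bool) → (W → Bool)) : Prop :=
  ∀ ψ b, runGates L ψ b = ψ (π b)

theorem IsDiag.append {L L' : List (Gate OneQubitGate W)} {f f' : (W → Bool) → ℂ}
    (h : IsDiag L f) (h' : IsDiag L' f') : IsDiag (L ++ L') (fun b => f b * f' b) := by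
  intro ψ b
  rw [runGates_append, h', h]
  ring

theorem IsDiag.flatMap {ι : Type} (S : List ι) {F : ι → List (Gate OneQubitGate W)}
    {f : ι → (W → Bool) → ℂ} (h : ∀ i, IsDiag (F i) (f i)) :
    IsDiag (S.flatMap F) (fun b => (S.map fun i => f i b).prod) := by
  induction S with
  | nil => intro ψ b; simp [runGates]
  | cons i S ih =>
    have := (h i).append ih
    simpa using this

/-- Compute, apply a phase, uncompute: the phase is then evaluated at the permuted basis state. All
fan-out layers have this use. -/
theorem IsDiag.conj {L D : List (Gate OneQubitGate W)} {f : (W → Bool) → ℂ}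
    {π : (W → Bool) → (W → Bool)} (hD : IsDiag D f) (hL : IsPerm L π) (hπ : ∀ b, π (π b) = b) :
    IsDiag (L ++ D ++ L) (fun b => f (π b)) := by
  intro ψ b
  rw [runGates_append, runGates_append, hL, hD, hL, hπ]

/-- A rotation as a phase. -/
theorem isDiag_rotationZ (α : ℝ) (w : W) :
    IsDiag [.one (rotationZ α) w] (fun b => if b w then Complex.exp (α * Complex.I) else 1) := by
  intro ψ b
  have h : ∀ c, Function.update b w c = b ↔ c = b w := fun c => by
    rw [Function.update_eq_iff]; simp
  cases hb : b w <;>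
    simp [runGates, Gate.apply, rotationZ, hb, Matrix.diagonal_apply] <;>
    rw [← hb, Function.update_eq_self]

/-- A layer of fan-out gates maps `b` to `b'`. -/
theorem runGates_fanout (L : List (Gate OneQubitGate W)) (ψ : State W) (b b' : W → Bool)
    (hnd : (L.flatMap Gate.qubits).Nodup) (hL : ∀ g ∈ L, ∃ c T, g = .fanout c T)
    (h1 : ∀ c T, .fanout c T ∈ L → ∀ j ∈ T, b' j = xor (b j) (b c))
    (h2 : ∀ j, (∀ c T, .fanout c T ∈ L → j ∉ T) → b' j = b j) :
    runGates L ψ b = ψ b' := by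
  induction L generalizing ψ b' with
  | nil =>
    have : b' = b := funext fun j => h2 j (by simp)
    rw [this]; rfl
  | cons g L ih =>
    obtain ⟨c, T, rfl⟩ := hL g (by simp)
    rw [List.flatMap_cons, List.nodup_append'] at hnd
    obtain ⟨hg, hnd', hdis⟩ := hnd
    have hdis' : ∀ j ∈ T, ∀ c' T', .fanout c' T' ∈ L → j ∉ T' := by
      intro j hj c' T' hm hj'
      exact hdis (a := j) (by simp [Gate.qubits, hj])
        (List.mem_flatMap.2 ⟨_, hm, by simp [Gate.qubits, hj']⟩)
    have hc : ∀ c' T', .fanout c' T' ∈ L → c ∉ T' := by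
      intro c' T' hm hj'
      exact hdis (a := c) (by simp [Gate.qubits])
        (List.mem_flatMap.2 ⟨_, hm, by simp [Gate.qubits, hj']⟩)
    have hcT : c ∉ T := (List.nodup_cons.1 hg).1
    -- The remaining gates touch neither the targets nor the control of the first gate. So their
    -- joint effect is `b'` with the bits in `T` restored.
    rw [runGates_cons, ih _ (fun j => if j ∈ T then b j else b' j) hnd'
      (fun g hg => hL g (by simp [hg]))]
    · simp only [Gate.apply]
      congr 1
      funext j
      have hbc : b' c = b c := by
        refine h2 c fun c' T' hm => ?_
        rcases List.mem_cons.1 hm with h | h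
        · cases h; exact hcT
        · exact hc c' T' h
      by_cases hj : j ∈ T
      · simp [hj, hcT, hbc, h1 c T (by simp) j hj]
      · simp [hj]
    · intro c' T' hm j hj
      have : j ∉ T := fun h => hdis' j h c' T' hm hj
      simp only [this, if_false]
      exact h1 c' T' (by simp [hm]) j hj
    · intro j hj
      by_cases hjT : j ∈ T
      · simp [hjT]
      · simp only [hjT, if_false]
        refine h2 j fun c' T' hm => ?_
        rcases List.mem_cons.1 hm with h | h
        · cases h; exact hjT
        · exact hj c' T' h

/-! ### Linearity and product states -/

section Product

theorem apply_sum {ι : Type} (T : Finset ι) (a : ι → ℂ) (φ : ι → State W)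
    (g : Gate OneQubitGate W) :
    g.apply (fun b => ∑ s ∈ T, a s * φ s b) = fun b => ∑ s ∈ T, a s * g.apply (φ s) b := by
  funext b
  cases g with
  | one U i =>
    simp only [Gate.apply, Finset.mul_sum]
    rw [Finset.sum_comm]
    exact Finset.sum_congr rfl fun s _ => Finset.sum_congr rfl fun c _ => by ring
  | fanout c T => rfl

theorem runGates_sum {ι : Type} (T : Finset ι) (a : ι → ℂ) (φ : ι → State W)
    (L : List (Gate OneQubitGate W)) :
    runGates L (fun b => ∑ s ∈ T, a s * φ s b) = fun b => ∑ s ∈ T, a s * runGates L (φ s) b := by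
  induction L generalizing φ with
  | nil => rfl
  | cons g L ih => rw [runGates_cons, apply_sum, ih]; rfl

theorem runGates_smul (L : List (Gate OneQubitGate W)) (a : ℂ) (ψ : State W) :
    runGates L (fun b => a * ψ b) = fun b => a * runGates L ψ b := by
  simpa using runGates_sum {()} (fun _ => a) (fun _ => ψ) L

variable [Fintype W]

theorem prodState_update (v : W → Bool → ℂ) (i : W) (u : Bool → ℂ) (b : W → Bool) :
    prodState (Function.update v i u) b = u (b i) * ∏ j ∈ Finset.univ.erase i, v j (b j) := by
  rw [prodState, ← Finset.mul_prod_erase _ _ (Finset.mem_univ i), Function.update_self]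
  congr 1
  refine Finset.prod_congr rfl fun j hj => ?_
  rw [Function.update_of_ne (Finset.ne_of_mem_erase hj)]

theorem apply_one_prodState (U : OneQubitGate) (i : W) (v : W → Bool → ℂ) :
    (Gate.one U i).apply (prodState v) =
      prodState (Function.update v i (fun β => ∑ c, (U : Matrix Bool Bool ℂ) β c * v i c)) := by
  funext b
  rw [prodState_update, Finset.sum_mul]
  refine Finset.sum_congr rfl fun c _ => ?_
  rw [prodState, ← Finset.mul_prod_erase _ _ (Finset.mem_univ i), Function.update_self, mul_assoc]
  congr 2
  refine Finset.prod_congr rfl fun j hj => ?_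
  rw [Function.update_of_ne (Finset.ne_of_mem_erase hj)]

/-- A layer of one-qubit gates on a product state. -/
theorem runGates_one_prodState (U : OneQubitGate) (S : List W) (hS : S.Nodup) (v : W → Bool → ℂ) :
    runGates (S.map (Gate.one U)) (prodState v) = prodState fun i =>
      if i ∈ S then fun β => ∑ c, (U : Matrix Bool Bool ℂ) β c * v i c else v i := by
  induction S generalizing v with
  | nil => simp [runGates]
  | cons w S ih =>
    rw [List.nodup_cons] at hS
    rw [List.map_cons, runGates_cons, apply_one_prodState, ih hS.2]
    congr 1
    funext i
    by_cases hw : i = w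
    · subst hw; simp [hS.1]
    · simp [hw]

/-- An operator is determined by the basis states. -/
theorem isPerm_of_single {L : List (Gate OneQubitGate W)} {π : (W → Bool) → (W → Bool)}
    (hπ : ∀ b, π (π b) = b) (h : ∀ s, runGates L (Pi.single s 1) = Pi.single (π s) 1) :
    IsPerm L π := by
  intro ψ b
  have e : ψ = fun b => ∑ s, ψ s * (Pi.single s 1 : State W) b := by
    funext b
    simp [Pi.single_apply]
  conv_lhs => rw [e]
  rw [runGates_sum]
  simp only [h, Pi.single_apply]
  rw [Finset.sum_eq_single (π b)]
  · simp [hπ]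
  · intro s _ hs
    rw [if_neg, mul_zero]
    rintro rfl
    exact hs (hπ s).symm
  · simp

end Product

theorem sum_hadamard (v : Bool → ℂ) (β : Bool) :
    ∑ c, (hadamard : Matrix Bool Bool ℂ) β c * v c =
      (v false + (if β then -1 else 1) * v true) / (√2 : ℂ) := by
  cases β <;> simp [hadamard] <;> ring

/-- A layer of Hadamard gates is an involution. -/
theorem runGates_hadamard_hadamard [Fintype W] (S : List W) (hS : S.Nodup) (ψ : State W) :
    runGates (S.map (Gate.one hadamard)) (runGates (S.map (Gate.one hadamard)) ψ) = ψ := by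
  rw [← runGates_append]
  funext b
  -- By linearity basis states suffice. These are product states, on which the claim concerns one
  -- qubit at a time.
  refine isPerm_of_single (L := S.map (Gate.one hadamard) ++ S.map (Gate.one hadamard))
    (π := id) (fun _ => rfl) (fun s => ?_) ψ b
  change _ = (Pi.single s 1 : State W)
  rw [runGates_append, single_eq_prodState, runGates_one_prodState _ _ hS,
    runGates_one_prodState _ _ hS]
  congr 1
  funext i
  by_cases hi : i ∈ S
  · have h2 : (√2 : ℂ) * (√2 : ℂ) = 2 := by
      rw [← Complex.ofReal_mul, Real.mul_self_sqrt (by norm_num)]; norm_num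
    have h0 : (√2 : ℂ) ≠ 0 := fun h => by simp [h] at h2
    simp only [hi, if_true]
    funext β
    rw [sum_hadamard, sum_hadamard, sum_hadamard]
    field_simp
    rw [pow_two, h2]
    cases β <;> cases s i <;> norm_num
  · simp [hi]

/-- Relabelling the qubits of a gate. -/
def Gate.relabel {G W W' : Type} (e : W → W') : Gate G W → Gate G W'
  | .one U i => .one U (e i)
  | .fanout c T => .fanout (e c) (T.map e)

theorem Gate.qubits_relabel {G W W' : Type} (e : W → W') (g : Gate G W) :
    (g.relabel e).qubits = g.qubits.map e := by
  cases g <;> rfl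

theorem Gate.map_relabel {G G' W W' : Type} (e : W → W') (f : G → G') (g : Gate G W) :
    (g.relabel e).map f = (g.map f).relabel e := by
  cases g <;> rfl

theorem runGates_relabel {W' : Type} [DecidableEq W'] (e : W ≃ W')
    (L : List (Gate OneQubitGate W)) (ψ : State W') (b : W → Bool) :
    runGates (L.map (Gate.relabel e)) ψ (b ∘ e.symm) = runGates L (fun b => ψ (b ∘ e.symm)) b := by
  induction L generalizing ψ with
  | nil => rfl
  | cons g L ih =>
    rw [List.map_cons, runGates_cons, runGates_cons, ih]
    congr 1
    funext b
    cases g with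
    | one U i =>
      simp only [Gate.relabel, Gate.apply]
      refine Finset.sum_congr rfl fun c _ => ?_
      congr 2
      · simp
      · funext j
        by_cases hj : j = e i
        · subst hj; simp
        · have : e.symm j ≠ i := fun h => hj (by simp [← h])
          simp [hj, this]
    | fanout c T =>
      simp only [Gate.relabel, Gate.apply]
      congr 1
      funext j
      have : j ∈ T.map e ↔ e.symm j ∈ T := by
        rw [List.mem_map]
        constructor
        · rintro ⟨a, ha, rfl⟩; simpa using ha
        · intro h; exact ⟨_, h, by simp⟩
      simp [this]

end Operators

/-! ### The circuit -/

/-- The qubits of the circuit: the input qubits `X`, the output qubit `Y`, the counters `C k n`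
with their copies, and copies `E k a` of the counters that are used to compute into `D a` the parity
of the counters `k` that are binary digits one of `a`. -/
inductive Site (n m : ℕ) : Type
  | X (i : Fin n)
  | Y
  | C (k : Fin m) (i : Fin (n + 1))
  | E (k : Fin m) (a : Fin (2 ^ m))
  | D (a : Fin (2 ^ m))

/-- The number of ancilla qubits. -/
abbrev numAncilla (n m : ℕ) : ℕ := m * (n + 1) + (m * 2 ^ m + 2 ^ m)

namespace Site

variable {n m : ℕ}

/-- The qubits as a sum type. -/
def equivSum : Site n m ≃
    Fin n ⊕ Fin 1 ⊕ ((Fin m × Fin (n + 1)) ⊕ ((Fin m × Fin (2 ^ m)) ⊕ Fin (2 ^ m))) where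
  toFun
    | X i => .inl i
    | Y => .inr (.inl 0)
    | C k i => .inr (.inr (.inl (k, i)))
    | E k a => .inr (.inr (.inr (.inl (k, a))))
    | D a => .inr (.inr (.inr (.inr a)))
  invFun
    | .inl i => X i
    | .inr (.inl _) => Y
    | .inr (.inr (.inl (k, i))) => C k i
    | .inr (.inr (.inr (.inl (k, a)))) => E k a
    | .inr (.inr (.inr (.inr a))) => D a
  left_inv s := by cases s <;> rfl
  right_inv s := by
    rcases s with i | j | ⟨k, i⟩ | ⟨k, a⟩ | a
    · rfl
    · rw [Subsingleton.elim j 0]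
    · rfl
    · rfl
    · rfl

instance : DecidableEq (Site n m) := equivSum.decidableEq

instance : Fintype (Site n m) := Fintype.ofEquiv _ equivSum.symm

/-- Splits the amplitude of a product state by the kinds of qubits, which the layers treat
differently. -/
theorem prod_eq (F : Site n m → ℂ) : ∏ s, F s = (∏ i, F (X i)) * (F Y *
    ((∏ k, ∏ i, F (C k i)) * ((∏ k, ∏ a, F (E k a)) * ∏ a, F (D a)))) := by
  rw [Fintype.prod_equiv equivSum F (fun s => F (equivSum.symm s)) (fun s => by simp)]
  simp [Fintype.prod_sum_type, Fintype.prod_prod_type, equivSum]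

/-- The numbering of the qubits. -/
def equivWire : Site n m ≃ Wire n (numAncilla n m) :=
  equivSum.trans (Equiv.sumCongr (Equiv.refl _) (Equiv.sumCongr (Equiv.refl _)
    ((Equiv.sumCongr finProdFinEquiv
      ((Equiv.sumCongr finProdFinEquiv (Equiv.refl _)).trans finSumFinEquiv)).trans
        finSumFinEquiv)))

/-- The number of a qubit. -/
def index (s : Site n m) : ℕ := Wire.index (equivWire s)

theorem index_X (i : Fin n) : index (X i : Site n m) = i := rfl

theorem index_Y : index (Y : Site n m) = n := rfl

/-- The layout row by row; this form and the next two are what `Printer.siteC`, `Printer.siteE` and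
`Printer.siteD` print. -/
theorem index_C (k : Fin m) (i : Fin (n + 1)) :
    index (C k i : Site n m) = n + 1 + (i + (n + 1) * k) := rfl

theorem index_E (k : Fin m) (a : Fin (2 ^ m)) :
    index (E k a : Site n m) = n + 1 + (m * (n + 1) + (a + 2 ^ m * k)) := rfl

theorem index_D (a : Fin (2 ^ m)) :
    index (D a : Site n m) = n + 1 + (m * (n + 1) + (m * 2 ^ m + a)) := rfl

end Site

open Site

/-- The word of the rotation by the angle `2π/q` or, if `s` is false, by `-2π/q`. -/
def phaseWord (s : Bool) (q : ℕ) : GateWord := [.Rz (bif s then 1 else q - 1) q]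

/-- A layer of gates on described qubits. -/
abbrev Layer (n m : ℕ) : Type := List (Gate GateWord (Site n m))

/-! ### The layers -/

section Layers

variable (n m : ℕ)

/-- A Hadamard gate on the output qubit. -/
def hadY : Layer n m := [Y].map (Gate.one [.H])

/-- Hadamard gates on the counters. -/
def hadC : Layer n m := ((List.finRange m).map fun k => C k (Fin.last n)).map (Gate.one [.H])

/-- The copying of the counters. -/
def fanC : Layer n m := (List.finRange m).map fun k =>
  .fanout (C k (Fin.last n)) ((List.finRange n).map fun i => C k i.castSucc)

/-- Rotations of the copies of the counters; the direction for copy `i` is `s i`. -/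
def phaseC (s : ℕ → Bool) : Layer n m := (List.finRange m).flatMap fun k =>
  (List.finRange (n + 1)).map fun i => .one (phaseWord (s i.1) (2 ^ (k.1 + 2))) (C k i)

/-- The addition of the input bits to the copies of the counters. -/
def fanX : Layer n m := (List.finRange n).map fun i =>
  .fanout (X i) ((List.finRange m).map fun k => C k i.castSucc)

/-- The copying of the counters to the qubits `E`. -/
def copyE : Layer n m := (List.finRange m).map fun k =>
  .fanout (C k (Fin.last n))
    (((List.finRange (2 ^ m)).filter fun a => a.1.testBit k).map fun a => E k a)

/-- Hadamard gates on the qubits `E` and `D`. -/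
def hadE : Layer n m := ((List.finRange (2 ^ m)).flatMap fun a =>
  D a :: (List.finRange m).map fun k => E k a).map (Gate.one [.H])

/-- Fan-out from the qubits `D` to the qubits `E`. -/
def fanD : Layer n m := (List.finRange (2 ^ m)).map fun a =>
  .fanout (D a) ((List.finRange m).map fun k => E k a)

/-- Rotations of the qubits `D`. -/
def phaseD (s : Bool) : Layer n m := (List.finRange (2 ^ m)).map fun a =>
  .one (phaseWord s (2 ^ (m + 1))) (D a)

/-- The addition of the output bit to the qubits `D`. -/
def fanY : Layer n m := [.fanout Y ((List.finRange (2 ^ m)).map fun a => D a)]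

/-- The layers that rotate the counters by multiples of `t - |x|`, or back. -/
def countLayers (t : ℕ) (s : Bool) : List (Layer n m) :=
  [hadC n m, fanC n m, phaseC n m fun i => s == decide (i < t), fanX n m, phaseC n m fun _ => s,
    fanX n m, fanC n m, hadC n m]

/-- The layers that change the sign if the output qubit is one and all counters are zero. -/
def signLayers : List (Layer n m) :=
  [copyE n m, hadE n m, fanD n m, hadE n m, phaseD n m false, fanY n m, phaseD n m true, fanY n m,
    hadE n m, fanD n m, hadE n m, copyE n m]

/-- The layers of the circuit. -/
def exactLayers (t : ℕ) : List (Layer n m) :=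
  [hadY n m] ++ countLayers n m t true ++ signLayers n m ++ countLayers n m t false ++ [hadY n m]

end Layers

/-! ### Gates of a layer act on distinct qubits -/

section Nodup

variable {n m : ℕ}

/-- The gates of a layer act on pairwise distinct qubits. -/
def Layer.Distinct (L : Layer n m) : Prop := (L.flatMap Gate.qubits).Nodup

theorem distinct_one (S : List (Site n m)) (hS : S.Nodup) (U : GateWord) :
    Layer.Distinct (S.map (Gate.one U)) := by
  rw [Layer.Distinct, List.flatMap_map]
  have : S.flatMap (fun a => Gate.qubits (Gate.one U a)) = S := by
    simp [Gate.qubits]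
  rwa [this]

theorem nodup_flatMap_finRange {α : Type} {N : ℕ} (f : Fin N → List α) (h1 : ∀ i, (f i).Nodup)
    (h2 : ∀ i j a, a ∈ f i → a ∈ f j → i = j) : ((List.finRange N).flatMap f).Nodup := by
  rw [List.nodup_flatMap]
  refine ⟨fun i _ => h1 i, (List.nodup_finRange N).pairwise_of_forall_ne ?_⟩
  intro i _ j _ hij a hi hj
  exact hij (h2 i j a hi hj)

theorem nodup_counters : ((List.finRange m).map fun k => (C k (Fin.last n) : Site n m)).Nodup :=
  (List.nodup_finRange m).map fun a b h => by simpa using h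

theorem nodup_parities : ((List.finRange (2 ^ m)).flatMap fun a =>
    (D a : Site n m) :: (List.finRange m).map fun k => E k a).Nodup := by
  refine nodup_flatMap_finRange _ (fun a => List.nodup_cons.2 ⟨by simp, ?_⟩) ?_
  · exact (List.nodup_finRange m).map fun a b h => by simpa using h
  · intro a b s h1 h2
    cases s <;> simp_all

theorem hadY_distinct : (hadY n m).Distinct := distinct_one _ (List.nodup_singleton _) _

theorem hadC_distinct : (hadC n m).Distinct := distinct_one _ nodup_counters _

theorem hadE_distinct : (hadE n m).Distinct := distinct_one _ nodup_parities _

theorem phaseC_distinct (s : ℕ → Bool) : (phaseC n m s).Distinct := by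
  rw [Layer.Distinct, phaseC, List.flatMap_assoc]
  refine nodup_flatMap_finRange _ (fun k => ?_) ?_
  · rw [List.flatMap_map]
    refine nodup_flatMap_finRange _ (fun i => by simp [Gate.qubits]) ?_
    intro i j a h1 h2
    simp only [Gate.qubits, List.mem_singleton] at h1 h2
    rw [h1] at h2
    simpa using h2
  · intro i j a h1 h2
    cases a <;> simp_all [Gate.qubits]

theorem phaseD_distinct (s : Bool) : (phaseD n m s).Distinct := by
  rw [Layer.Distinct, phaseD, List.flatMap_map]
  refine nodup_flatMap_finRange _ (fun i => by simp [Gate.qubits]) ?_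
  intro i j a h1 h2
  simp only [Gate.qubits, List.mem_singleton] at h1 h2
  rw [h1] at h2
  simpa using h2

theorem fanC_distinct : (fanC n m).Distinct := by
  rw [Layer.Distinct, fanC, List.flatMap_map]
  refine nodup_flatMap_finRange _ (fun k => List.nodup_cons.2 ⟨?_, ?_⟩) ?_
  · simp [Fin.castSucc_ne_last]
  · exact (List.nodup_finRange n).map fun a b h => by simpa using h
  · intro i j a h1 h2
    cases a <;> simp_all [Gate.qubits]
    grind

theorem fanX_distinct : (fanX n m).Distinct := by
  rw [Layer.Distinct, fanX, List.flatMap_map]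
  refine nodup_flatMap_finRange _ (fun k => List.nodup_cons.2 ⟨by simp, ?_⟩) ?_
  · exact (List.nodup_finRange m).map fun a b h => by simpa using h
  · intro i j a h1 h2
    cases a <;> simp_all [Gate.qubits]
    exact Fin.castSucc_injective _ (h1.trans h2.symm)

theorem copyE_distinct : (copyE n m).Distinct := by
  rw [Layer.Distinct, copyE, List.flatMap_map]
  refine nodup_flatMap_finRange _ (fun k => List.nodup_cons.2 ⟨by simp, ?_⟩) ?_
  · exact ((List.nodup_finRange _).filter _).map fun a b h => by simpa using h
  · intro i j a h1 h2
    cases a <;> simp_all [Gate.qubits]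

theorem fanD_distinct : (fanD n m).Distinct := by
  rw [Layer.Distinct, fanD, List.flatMap_map]
  refine nodup_flatMap_finRange _ (fun k => List.nodup_cons.2 ⟨by simp, ?_⟩) ?_
  · exact (List.nodup_finRange _).map fun a b h => by simpa using h
  · intro i j a h1 h2
    cases a <;> simp_all [Gate.qubits]

theorem fanY_distinct : (fanY n m).Distinct := by
  simp only [Layer.Distinct, fanY, List.flatMap_singleton, Gate.qubits]
  refine List.nodup_cons.2 ⟨by simp, ?_⟩
  exact (List.nodup_finRange _).map fun a b h => by simpa using h

theorem exactLayers_distinct {t : ℕ} {L : Layer n m} (hL : L ∈ exactLayers n m t) :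
    L.Distinct := by
  simp only [exactLayers, countLayers, signLayers, List.mem_append, List.mem_cons,
    List.not_mem_nil, or_false] at hL
  rcases hL with (((h | h) | h) | h) | h
  · subst h; exact hadY_distinct
  · rcases h with h | h | h | h | h | h | h | h <;> subst h
    exacts [hadC_distinct, fanC_distinct, phaseC_distinct _, fanX_distinct, phaseC_distinct _,
      fanX_distinct, fanC_distinct, hadC_distinct]
  · rcases h with h | h | h | h | h | h | h | h | h | h | h | h <;> subst h
    exacts [copyE_distinct, hadE_distinct, fanD_distinct, hadE_distinct, phaseD_distinct _,
      fanY_distinct, phaseD_distinct _, fanY_distinct, hadE_distinct, fanD_distinct, hadE_distinct,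
      copyE_distinct]
  · rcases h with h | h | h | h | h | h | h | h <;> subst h
    exacts [hadC_distinct, fanC_distinct, phaseC_distinct _, fanX_distinct, phaseC_distinct _,
      fanX_distinct, fanC_distinct, hadC_distinct]
  · subst h; exact hadY_distinct

end Nodup

/-- The circuit with described one-qubit gates. -/
def exactCircuit (n m t : ℕ) : Circuit GateWord n (numAncilla n m) where
  layers := (exactLayers n m t).map (List.map (Gate.relabel equivWire))
  nodup := by
    intro L hL
    obtain ⟨L', hL', rfl⟩ := List.mem_map.1 hL
    rw [List.flatMap_map]
    simp only [Gate.qubits_relabel]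
    rw [← List.map_flatMap]
    exact (exactLayers_distinct hL').map equivWire.injective

open Site

/-! ### The operators of the layers -/

section Semantics

variable {n m : ℕ}

/-- The gates denoted by a layer. -/
def denote (L : Layer n m) : List (Gate OneQubitGate (Site n m)) := L.map (Gate.map GateWord.gate)

theorem denote_distinct {L : Layer n m} (h : L.Distinct) :
    ((denote L).flatMap Gate.qubits).Nodup := by
  rw [denote, List.flatMap_map]
  simp only [Gate.qubits_map]
  exact h

theorem gate_hadamard : GateWord.gate [.H] = hadamard := by
  simp [GateWord.gate, Letter.gate]

theorem denote_hadamard (S : List (Site n m)) :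
    denote (S.map (Gate.one [.H])) = S.map (Gate.one hadamard) := by
  simp [denote, Gate.map, gate_hadamard]

/-- The primitive `q`-th root of unity. -/
def zeta (q : ℕ) : ℂ := Complex.exp (2 * Real.pi * Complex.I / q)

theorem zeta_ne_zero (q : ℕ) : zeta q ≠ 0 := Complex.exp_ne_zero _

theorem zeta_pow (q : ℕ) (hq : q ≠ 0) : zeta q ^ q = 1 :=
  (Complex.isPrimitiveRoot_exp q hq).pow_eq_one

theorem zeta_half (k : ℕ) : zeta (2 ^ (k + 1)) ^ (2 ^ k) = -1 := by
  rw [zeta, ← Complex.exp_nat_mul, ← Complex.exp_pi_mul_I]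
  congr 1
  push_cast
  field_simp
  ring

/-- The phase of a rotation by `±2π/q`. -/
def phase (s : Bool) (q : ℕ) (β : Bool) : ℂ := if β then (if s then zeta q else (zeta q)⁻¹) else 1

/-- Letters have natural numerators only, so the inverse rotation is written as ζ^(q-1) = ζ⁻¹. -/
theorem isDiag_phaseWord (s : Bool) (q : ℕ) (hq : q ≠ 0) (w : Site n m) :
    IsDiag [.one (phaseWord s q).gate w] (fun b => phase s q (b w)) := by
  have h : (phaseWord s q).gate = rotationZ (2 * Real.pi * (bif s then 1 else q - 1 : ℕ) / q) := by
    simp [phaseWord, GateWord.gate, Letter.gate]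
  rw [h]
  convert isDiag_rotationZ (2 * Real.pi * (bif s then 1 else q - 1 : ℕ) / q) w using 3 with b
  cases hb : b w
  · simp [phase]
  · simp only [phase, if_true]
    have hz : ∀ p : ℕ, Complex.exp ((2 * Real.pi * (p : ℝ) / q : ℝ) * Complex.I) = zeta q ^ p := by
      intro p
      rw [zeta, ← Complex.exp_nat_mul]
      congr 1
      push_cast
      ring
    rw [hz]
    cases s
    · simp only [Bool.false_eq_true, if_false, cond_false]
      rw [inv_eq_iff_eq_inv, ← mul_eq_one_iff_eq_inv₀ (pow_ne_zero _ (zeta_ne_zero q)), ← pow_succ',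
        Nat.sub_add_cancel (Nat.one_le_iff_ne_zero.2 hq), zeta_pow q hq]
    · simp

theorem prod_map_finRange {N : ℕ} (f : Fin N → ℂ) : ((List.finRange N).map f).prod = ∏ i, f i :=
  (Fin.prod_univ_def f).symm

theorem isDiag_phaseC (s : ℕ → Bool) : IsDiag (denote (phaseC n m s)) (fun b =>
    ∏ k : Fin m, ∏ i : Fin (n + 1), phase (s i.1) (2 ^ (k.1 + 2)) (b (C k i))) := by
  have h := IsDiag.flatMap (List.finRange m) fun k : Fin m => IsDiag.flatMap
    (List.finRange (n + 1)) fun i : Fin (n + 1) =>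
    isDiag_phaseWord (s i.1) (2 ^ (k.1 + 2)) (by positivity) (C k i : Site n m)
  simp only [prod_map_finRange] at h
  convert h using 1
  simp [denote, phaseC, List.map_flatMap, Gate.map, ← List.map_eq_flatMap, Function.comp_def]

theorem isDiag_phaseD (s : Bool) : IsDiag (denote (phaseD n m s)) (fun b =>
    ∏ a : Fin (2 ^ m), phase s (2 ^ (m + 1)) (b (D a))) := by
  have h := IsDiag.flatMap (List.finRange (2 ^ m)) fun a : Fin (2 ^ m) =>
    isDiag_phaseWord s (2 ^ (m + 1)) (by positivity) (D a : Site n m)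
  simp only [prod_map_finRange] at h
  convert h using 1
  simp [denote, phaseD, Gate.map, ← List.map_eq_flatMap, Function.comp_def]

/-- The permutation of basis states in `fanC`. -/
def fanCMap (b : Site n m → Bool) : Site n m → Bool
  | C k i => if i = Fin.last n then b (C k i) else xor (b (C k i)) (b (C k (Fin.last n)))
  | s => b s

/-- The permutation of basis states in `fanX`. -/
def fanXMap (b : Site n m → Bool) : Site n m → Bool
  | C k i => if h : i.1 < n then xor (b (C k i)) (b (X ⟨i, h⟩)) else b (C k i)
  | s => b s

/-- The permutation of basis states in `copyE`. -/
def copyEMap (b : Site n m → Bool) : Site n m → Bool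
  | E k a => xor (b (E k a)) (a.1.testBit k && b (C k (Fin.last n)))
  | s => b s

/-- The permutation of basis states in `fanD`. -/
def fanDMap (b : Site n m → Bool) : Site n m → Bool
  | E k a => xor (b (E k a)) (b (D a))
  | s => b s

/-- The permutation of basis states in `fanY`. -/
def fanYMap (b : Site n m → Bool) : Site n m → Bool
  | D a => xor (b (D a)) (b Y)
  | s => b s

/-- The parity of bits. -/
def parity {N : ℕ} (v : Fin N → Bool) : Bool := ((List.finRange N).map v).foldr xor false

/-- The permutation of basis states in `fanD` between Hadamard gates. -/
def parityMap (b : Site n m → Bool) : Site n m → Bool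
  | D a => xor (b (D a)) (parity fun k => b (E k a))
  | s => b s

theorem fanCMap_fanCMap (b : Site n m → Bool) : fanCMap (fanCMap b) = b := by
  funext s
  cases s <;> simp [fanCMap]
  split_ifs <;> simp

theorem fanXMap_fanXMap (b : Site n m → Bool) : fanXMap (fanXMap b) = b := by
  funext s
  cases s <;> simp [fanXMap]
  split_ifs <;> simp

theorem copyEMap_copyEMap (b : Site n m → Bool) : copyEMap (copyEMap b) = b := by
  funext s
  cases s <;> simp [copyEMap]

theorem fanYMap_fanYMap (b : Site n m → Bool) : fanYMap (fanYMap b) = b := by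
  funext s
  cases s <;> simp [fanYMap]

theorem parityMap_parityMap (b : Site n m → Bool) : parityMap (parityMap b) = b := by
  funext s
  cases s <;> simp [parityMap]

/-- Reduces each fan-out layer to a check at its targets and at the qubits that are not targets. -/
theorem isPerm_fanout {L : Layer n m} (hd : L.Distinct) (π : (Site n m → Bool) → Site n m → Bool)
    (hL : ∀ g ∈ L, ∃ c T, g = .fanout c T)
    (h1 : ∀ b c T, .fanout c T ∈ L → ∀ j ∈ T, π b j = xor (b j) (b c))
    (h2 : ∀ b j, (∀ c T, .fanout c T ∈ L → j ∉ T) → π b j = b j) : IsPerm (denote L) π := by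
  have hmem : ∀ c T, .fanout c T ∈ denote L ↔ .fanout c T ∈ L := by
    intro c T
    rw [denote, List.mem_map]
    constructor
    · rintro ⟨g, hg, h⟩
      obtain ⟨c', T', rfl⟩ := hL g hg
      simp only [Gate.map, Gate.fanout.injEq] at h
      obtain ⟨rfl, rfl⟩ := h
      exact hg
    · intro h
      exact ⟨_, h, rfl⟩
  intro ψ b
  refine runGates_fanout _ ψ b (π b) (denote_distinct hd) ?_ ?_ ?_
  · intro g hg
    obtain ⟨g', hg', rfl⟩ := List.mem_map.1 hg
    obtain ⟨c, T, rfl⟩ := hL g' hg'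
    exact ⟨c, T, rfl⟩
  · intro c T h
    exact h1 b c T ((hmem c T).1 h)
  · intro j h
    exact h2 b j fun c T hcT => h c T ((hmem c T).2 hcT)

theorem isPerm_fanC : IsPerm (denote (fanC n m)) fanCMap := by
  refine isPerm_fanout fanC_distinct _ ?_ ?_ ?_
  · simp [fanC]
  · intro b c T h j hj
    simp only [fanC, List.mem_map, List.mem_finRange, true_and, Gate.fanout.injEq] at h
    obtain ⟨k, rfl, rfl⟩ := h
    simp only [List.mem_map, List.mem_finRange, true_and] at hj
    obtain ⟨i, rfl⟩ := hj
    simp [fanCMap, Fin.castSucc_ne_last]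
  · intro b j h
    cases j with
    | C k i =>
      by_cases hi : i = Fin.last n
      · simp [fanCMap, hi]
      · refine absurd ?_ (h (C k (Fin.last n)) _ (List.mem_map.2 ⟨k, List.mem_finRange k, rfl⟩))
        exact List.mem_map.2 ⟨i.castPred hi, List.mem_finRange _, by simp⟩
    | _ => rfl

theorem isPerm_fanX : IsPerm (denote (fanX n m)) fanXMap := by
  refine isPerm_fanout fanX_distinct _ ?_ ?_ ?_
  · simp [fanX]
  · intro b c T h j hj
    simp only [fanX, List.mem_map, List.mem_finRange, true_and, Gate.fanout.injEq] at h
    obtain ⟨i, rfl, rfl⟩ := h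
    simp only [List.mem_map, List.mem_finRange, true_and] at hj
    obtain ⟨k, rfl⟩ := hj
    simp [fanXMap]
  · intro b j h
    cases j with
    | C k i =>
      by_cases hi : i.1 < n
      · refine absurd ?_ (h (X ⟨i, hi⟩) _ (List.mem_map.2 ⟨⟨i, hi⟩, List.mem_finRange _, rfl⟩))
        exact List.mem_map.2 ⟨k, List.mem_finRange _, by simp⟩
      · simp [fanXMap, hi]
    | _ => rfl

theorem isPerm_copyE : IsPerm (denote (copyE n m)) copyEMap := by
  refine isPerm_fanout copyE_distinct _ ?_ ?_ ?_
  · simp [copyE]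
  · intro b c T h j hj
    simp only [copyE, List.mem_map, List.mem_finRange, true_and, Gate.fanout.injEq] at h
    obtain ⟨k, rfl, rfl⟩ := h
    simp only [List.mem_map, List.mem_filter, List.mem_finRange, true_and] at hj
    obtain ⟨a, ha, rfl⟩ := hj
    simp [copyEMap, ha]
  · intro b j h
    cases j with
    | E k a =>
      cases ha : a.1.testBit k with
      | false => simp [copyEMap, ha]
      | true =>
        refine absurd ?_ (h (C k (Fin.last n)) _ (List.mem_map.2 ⟨k, List.mem_finRange k, rfl⟩))
        exact List.mem_map.2 ⟨a, List.mem_filter.2 ⟨List.mem_finRange _, ha⟩, rfl⟩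
    | _ => rfl

theorem isPerm_fanD : IsPerm (denote (fanD n m)) fanDMap := by
  refine isPerm_fanout fanD_distinct _ ?_ ?_ ?_
  · simp [fanD]
  · intro b c T h j hj
    simp only [fanD, List.mem_map, List.mem_finRange, true_and, Gate.fanout.injEq] at h
    obtain ⟨a, rfl, rfl⟩ := h
    simp only [List.mem_map, List.mem_finRange, true_and] at hj
    obtain ⟨k, rfl⟩ := hj
    simp [fanDMap]
  · intro b j h
    cases j with
    | E k a =>
      refine absurd ?_ (h (D a) _ (List.mem_map.2 ⟨a, List.mem_finRange a, rfl⟩))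
      exact List.mem_map.2 ⟨k, List.mem_finRange _, rfl⟩
    | _ => rfl

theorem isPerm_fanY : IsPerm (denote (fanY n m)) fanYMap := by
  refine isPerm_fanout fanY_distinct _ ?_ ?_ ?_
  · simp [fanY]
  · intro b c T h j hj
    simp only [fanY, List.mem_singleton, Gate.fanout.injEq] at h
    obtain ⟨rfl, rfl⟩ := h
    simp only [List.mem_map, List.mem_finRange, true_and] at hj
    obtain ⟨a, rfl⟩ := hj
    simp [fanYMap]
  · intro b j h
    cases j with
    | D a =>
      refine absurd ?_ (h Y _ (List.mem_singleton.2 rfl))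
      exact List.mem_map.2 ⟨a, List.mem_finRange _, rfl⟩
    | _ => rfl

/-- The sign of a bit. -/
def sgn (β : Bool) : ℤ := if β then -1 else 1

theorem sgn_xor (β γ : Bool) : sgn (xor β γ) = sgn β * sgn γ := by
  cases β <;> cases γ <;> rfl

theorem sgn_parity {N : ℕ} (v : Fin N → Bool) : sgn (parity v) = ∏ i, sgn (v i) := by
  rw [Fin.prod_univ_def, parity]
  induction List.finRange N with
  | nil => rfl
  | cons i S ih => simp [sgn_xor, ih]

theorem sgn_and_parity {N : ℕ} (β : Bool) (v : Fin N → Bool) :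
    sgn (β && parity v) = ∏ i, sgn (β && v i) := by
  cases β
  · simp [sgn]
  · simpa using sgn_parity v

/-- Hadamard gates turn a basis state s into the character b ↦ (-1)^(b·s), up to normalisation.
Adding b(D a) to every b(E k a) inside the character contributes the factors (-1)^(b(D a) s(E k a)),
which amounts to adding the parity of the s(E k a) to s(D a). So control and targets exchange their
roles, and the second layer of Hadamard gates returns to a basis state. -/
theorem isPerm_parity :
    IsPerm (denote (hadE n m) ++ denote (fanD n m) ++ denote (hadE n m)) parityMap := by
  refine isPerm_of_single parityMap_parityMap fun s => ?_
  rw [hadE, denote_hadamard, runGates_append, runGates_append]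
  set S := (List.finRange (2 ^ m)).flatMap fun a =>
    (D a : Site n m) :: (List.finRange m).map fun k => E k a with hS
  have hSn : S.Nodup := nodup_parities
  have key : runGates (denote (fanD n m)) (runGates (S.map (Gate.one hadamard)) (Pi.single s 1)) =
      runGates (S.map (Gate.one hadamard)) (Pi.single (parityMap s) 1) := by
    funext b
    rw [isPerm_fanD, single_eq_prodState, single_eq_prodState, runGates_one_prodState _ _ hSn,
      runGates_one_prodState _ _ hSn]
    have hD : ∀ a, D a ∈ S := fun a => by simp [hS]
    have hE : ∀ k a, E k a ∈ S := fun k a => by simp [hS]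
    have hX : ∀ i, X i ∉ S := fun i => by simp [hS]
    have hY : Y ∉ S := by simp [hS]
    have hC : ∀ k i, C k i ∉ S := fun k i => by simp [hS]
    have hh : ∀ β γ : Bool, (∑ c, (hadamard : Matrix Bool Bool ℂ) β c * if c = γ then 1 else 0) =
        sgn (β && γ) / (√2 : ℂ) := by
      intro β γ
      rw [sum_hadamard]
      cases β <;> cases γ <;> simp [sgn]
    simp only [prodState, Site.prod_eq, hD, hE, hX, hY, hC, if_true, if_false, hh]
    simp only [fanDMap, parityMap]
    congr 3
    have h1 : ∀ (k : Fin m) (a : Fin (2 ^ m)),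
        (sgn (xor (b (E k a)) (b (D a)) && s (E k a)) : ℂ) / (√2 : ℂ) =
        (sgn (b (E k a) && s (E k a)) : ℂ) / (√2 : ℂ) * sgn (b (D a) && s (E k a)) := by
      intro k a
      rw [Bool.and_xor_distrib_right, sgn_xor]
      push_cast
      ring
    have h2 : ∀ a : Fin (2 ^ m),
        (sgn (b (D a) && xor (s (D a)) (parity fun k => s (E k a))) : ℂ) / (√2 : ℂ) =
        (sgn (b (D a) && s (D a)) : ℂ) / (√2 : ℂ) * ∏ k, (sgn (b (D a) && s (E k a)) : ℂ) := by
      intro a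
      rw [Bool.and_xor_distrib_left, sgn_xor, sgn_and_parity]
      push_cast
      ring
    simp only [h1, h2, Finset.prod_mul_distrib]
    rw [Finset.prod_comm (f := fun k a => (sgn (b (D a) && s (E k a)) : ℂ))]
    ring
  rw [key, runGates_hadamard_hadamard _ hSn]

end Semantics

open Site

section Semantics

variable {n m : ℕ}

/-- The operator of a list of layers. -/
def runLayers (Ls : List (Layer n m)) (ψ : State (Site n m)) : State (Site n m) :=
  runGates (denote Ls.flatten) ψ

theorem denote_append (L L' : Layer n m) : denote (L ++ L') = denote L ++ denote L' := by
  simp [denote]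

theorem runLayers_append (Ls Ls' : List (Layer n m)) (ψ : State (Site n m)) :
    runLayers (Ls ++ Ls') ψ = runLayers Ls' (runLayers Ls ψ) := by
  rw [runLayers, List.flatten_append, denote_append, runGates_append]; rfl

/-! ### The sign -/

/-- Expanding the product on the right gives one term for each subset of the factors, that is, for
each `m`-bit number `a`. The induction separates the leading bit of `a`. -/
theorem sum_prod_testBit (c : ℕ → Bool) (m : ℕ) :
    ∑ a ∈ Finset.range (2 ^ m), ∏ k ∈ Finset.range m, sgn (a.testBit k && c k) =
      ∏ k ∈ Finset.range m, (1 + sgn (c k)) := by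
  induction m with
  | zero => simp
  | succ m ih =>
    rw [pow_succ, mul_two, Finset.sum_range_add, Finset.prod_range_succ, mul_add, mul_one, ← ih]
    congr 1
    · refine Finset.sum_congr rfl fun a ha => ?_
      rw [Finset.prod_range_succ, Nat.testBit_lt_two_pow (Finset.mem_range.1 ha)]
      simp [sgn]
    · rw [Finset.sum_mul]
      refine Finset.sum_congr rfl fun a ha => ?_
      rw [Finset.prod_range_succ, Nat.testBit_two_pow_add_eq,
        Nat.testBit_lt_two_pow (Finset.mem_range.1 ha)]
      simp only [Bool.not_false, Bool.true_and]
      congr 1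
      refine Finset.prod_congr rfl fun k hk => ?_
      rw [Nat.testBit_two_pow_add_gt (Finset.mem_range.1 hk)]

/-- Orthogonality of characters: one nonzero bit of `c` makes a factor `1 + sgn (c k)` vanish. -/
theorem sum_sgn_parity (c : Fin m → Bool) :
    ∑ a : Fin (2 ^ m), sgn (parity fun k : Fin m => a.1.testBit k && c k) =
      if ∀ k, c k = false then 2 ^ m else 0 := by
  set c' : ℕ → Bool := fun k => if h : k < m then c ⟨k, h⟩ else false with hc'
  have h := sum_prod_testBit c' m
  rw [Finset.sum_range] at h
  simp only [Finset.prod_range] at h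
  have e : ∀ k : Fin m, c' k = c k := fun k => by simp [hc']
  simp only [e] at h
  simp only [sgn_parity, h]
  split_ifs with h0
  · simp [h0, sgn]
  · push Not at h0
    obtain ⟨k, hk⟩ := h0
    refine Finset.prod_eq_zero (Finset.mem_univ k) ?_
    simp [sgn, hk]

/-- The ancillas other than the counters are zero. -/
def Clean (b : Site n m → Bool) : Prop := (∀ k a, b (E k a) = false) ∧ ∀ a, b (D a) = false

/-- The layers form nested conjugations around rotations, so the operator is diagonal on all states.
Only on clean basis states do the qubits `D a` hold the parities a·c, and only there is the phase
needed. -/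
theorem signLayers_apply : ∃ f : (Site n m → Bool) → ℂ,
    (∀ ψ b, runLayers (signLayers n m) ψ b = f b * ψ b) ∧
    ∀ b, Clean b → f b = if b Y = true ∧ ∀ k, b (C k (Fin.last n)) = false then -1 else 1 := by
  have h := (((isDiag_phaseD (n := n) (m := m) false).append
    ((isDiag_phaseD true).conj isPerm_fanY fanYMap_fanYMap)).conj isPerm_parity
      parityMap_parityMap).conj isPerm_copyE copyEMap_copyEMap
  refine ⟨fun b => (∏ a, phase false (2 ^ (m + 1)) (parityMap (copyEMap b) (D a))) *
    ∏ a, phase true (2 ^ (m + 1)) (fanYMap (parityMap (copyEMap b)) (D a)), fun ψ b => ?_, ?_⟩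
  · rw [← h ψ b, runLayers]
    congr 1
    simp [signLayers, denote_append, List.flatten]
  · rintro b ⟨hE, hD⟩
    set c : Fin m → Bool := fun k => b (C k (Fin.last n)) with hc
    have e1 : ∀ a, parityMap (copyEMap b) (D a) = parity fun k : Fin m => a.1.testBit k && c k := by
      intro a
      simp [parityMap, copyEMap, hE, hD, hc]
    have e2 : parityMap (copyEMap b) Y = b Y := rfl
    simp only [e1, e2, fanYMap, ← Finset.prod_mul_distrib]
    set z := zeta (2 ^ (m + 1)) with hz
    have hz0 : z ≠ 0 := zeta_ne_zero _
    cases hY : b Y with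
    | false =>
      simp only [Bool.xor_false, Bool.false_eq_true, false_and, if_false]
      refine Finset.prod_eq_one fun a _ => ?_
      rw [phase, phase]
      split_ifs <;> simp_all
    | true =>
      -- With output bit one, a zero parity is rotated only by the second rotation and a one only by
      -- the first, inverse, one. With output bit zero the two rotations cancel.
      have e3 : ∀ β : Bool, phase false (2 ^ (m + 1)) β * phase true (2 ^ (m + 1)) (xor β true) =
          z ^ sgn β := by
        intro β
        cases β <;> simp [phase, sgn, ← hz]
      have e4 : ∀ (S : Finset (Fin (2 ^ m))) (g : Fin (2 ^ m) → ℤ),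
          ∏ a ∈ S, z ^ g a = z ^ ∑ a ∈ S, g a := by
        intro S g
        induction S using Finset.induction_on with
        | empty => simp
        | insert a S ha ih => rw [Finset.prod_insert ha, Finset.sum_insert ha, zpow_add₀ hz0, ih]
      simp only [e3, e4, sum_sgn_parity, true_and]
      split_ifs with h0
      -- For zero counters the exponent is `2 ^ m`, half the order of `z`; otherwise it is zero.
      · rw [← zeta_half m, ← hz]
        exact_mod_cast zpow_natCast z (2 ^ m)
      · simp

/-! ### The counters -/

/-- The product states with clean ancillas, up to the output qubit and the counters. -/
def cleanState (x : Fin n → Bool) (η : Bool → ℂ) (c : Fin m → Bool → ℂ) :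
    Site n m → Bool → ℂ
  | X i => fun β => if β = x i then 1 else 0
  | Y => η
  | C k i => if i = Fin.last n then c k else fun β => if β = false then 1 else 0
  | E _ _ => fun β => if β = false then 1 else 0
  | D _ => fun β => if β = false then 1 else 0

/-- The basis states that occur in such a product state. -/
def Supported (x : Fin n → Bool) (b : Site n m → Bool) : Prop :=
  (∀ i, b (X i) = x i) ∧ (∀ k, ∀ i : Fin n, b (C k i.castSucc) = false) ∧ Clean b

-- Diagonal operators need be known only on the support of the state; this identity separates the
-- support from the free factors.
open Classical in
theorem prodState_cleanState (x : Fin n → Bool) (η : Bool → ℂ) (c : Fin m → Bool → ℂ)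
    (b : Site n m → Bool) : prodState (cleanState x η c) b =
      if Supported x b then η (b Y) * ∏ k, c k (b (C k (Fin.last n))) else 0 := by
  split_ifs with h
  · obtain ⟨h1, h2, h3, h4⟩ := h
    rw [prodState, Site.prod_eq]
    simp [cleanState, h1, h3, h4, Fin.prod_univ_castSucc, h2, Fin.castSucc_ne_last]
  · rw [prodState]
    have hz : ∃ s, cleanState x η c s (b s) = 0 := by
      by_contra hne
      push Not at hne
      refine h ⟨fun i => ?_, fun k i => ?_, fun k a => ?_, fun a => ?_⟩
      · have := hne (X i)
        simpa [cleanState] using this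
      · have := hne (C k i.castSucc)
        simpa [cleanState, Fin.castSucc_ne_last] using this
      · have := hne (E k a)
        simpa [cleanState] using this
      · have := hne (D a)
        simpa [cleanState] using this
    obtain ⟨s, hs⟩ := hz
    exact Finset.prod_eq_zero (Finset.mem_univ s) hs

/-- The Hadamard transform of a one-qubit state. -/
def hadTransform (v : Bool → ℂ) (β : Bool) : ℂ :=
  (v false + (if β then -1 else 1) * v true) / (√2 : ℂ)

theorem hadTransform_hadTransform (v : Bool → ℂ) : hadTransform (hadTransform v) = v := by
  have h2 : (√2 : ℂ) * (√2 : ℂ) = 2 := by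
    rw [← Complex.ofReal_mul, Real.mul_self_sqrt (by norm_num)]; norm_num
  have h0 : (√2 : ℂ) ≠ 0 := fun h => by simp [h] at h2
  funext β
  simp only [hadTransform]
  field_simp
  rw [pow_two, h2]
  cases β <;> norm_num <;> ring

theorem runGates_hadC (x : Fin n → Bool) (η : Bool → ℂ) (c : Fin m → Bool → ℂ) :
    runGates (denote (hadC n m)) (prodState (cleanState x η c)) =
      prodState (cleanState x η fun k => hadTransform (c k)) := by
  rw [hadC, denote_hadamard, runGates_one_prodState _ _ nodup_counters]
  congr 1
  funext s β
  cases s with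
  | C k i =>
    by_cases hi : i = Fin.last n
    · subst hi
      simp only [List.mem_map, List.mem_finRange, true_and, C.injEq, and_true, exists_eq, if_true,
        cleanState]
      rw [sum_hadamard, hadTransform]
    · have : ¬ Fin.last n = i := fun h => hi h.symm
      simp [cleanState, hi, this]
  | _ => simp [cleanState]

theorem runGates_hadY (x : Fin n → Bool) (η : Bool → ℂ) (c : Fin m → Bool → ℂ) :
    runGates (denote (hadY n m)) (prodState (cleanState x η c)) =
      prodState (cleanState x (hadTransform η) c) := by
  rw [hadY, denote_hadamard, runGates_one_prodState _ _ (List.nodup_singleton _)]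
  congr 1
  funext s β
  cases s with
  | Y =>
    simp only [List.mem_singleton, if_true, cleanState]
    rw [sum_hadamard, hadTransform]
  | _ => simp [cleanState]

/-- The phase factors between the Hadamard gates on the counters. -/
def countPhase (t : ℕ) (s : Bool) (b : Site n m → Bool) : ℂ :=
  (∏ k : Fin m, ∏ i : Fin (n + 1), phase (s == decide (i.1 < t)) (2 ^ (k.1 + 2))
    (fanCMap b (C k i))) *
  ∏ k : Fin m, ∏ i : Fin (n + 1), phase s (2 ^ (k.1 + 2)) (fanXMap (fanCMap b) (C k i))

/-- Copying the counters and adding the input bits are conjugations, so everything between the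
Hadamard layers is diagonal. -/
theorem countLayers_apply (t : ℕ) (s : Bool) (ψ : State (Site n m)) :
    runLayers (countLayers n m t s) ψ = runGates (denote (hadC n m))
      (fun b => countPhase t s b * runGates (denote (hadC n m)) ψ b) := by
  have h := ((isDiag_phaseC (n := n) (m := m) fun i => s == decide (i < t)).append
    ((isDiag_phaseC fun _ => s).conj isPerm_fanX fanXMap_fanXMap)).conj isPerm_fanC fanCMap_fanCMap
  have e : denote (countLayers n m t s).flatten = denote (hadC n m) ++
      (denote (fanC n m) ++ (denote (phaseC n m fun i => s == decide (i < t)) ++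
        (denote (fanX n m) ++ denote (phaseC n m fun _ => s) ++ denote (fanX n m))) ++
          denote (fanC n m)) ++ denote (hadC n m) := by
    simp [countLayers, denote_append, List.flatten]
  rw [runLayers, e, runGates_append, runGates_append]
  congr 1
  funext b
  exact h _ b

theorem phase_mul_phase_not (s : Bool) (q : ℕ) (β : Bool) : phase (!s) q β * phase s q β = 1 := by
  cases s <;> cases β <;> simp [phase, zeta_ne_zero]

theorem countPhase_mul (t : ℕ) (b : Site n m → Bool) :
    countPhase t false b * countPhase t true b = 1 := by
  rw [countPhase, countPhase, mul_mul_mul_comm]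
  simp only [← Finset.prod_mul_distrib]
  have h1 : ∀ i : ℕ, (false == decide (i < t)) = !(true == decide (i < t)) := by
    intro i; cases decide (i < t) <;> rfl
  have h2 : ∀ q β, phase false q β * phase true q β = 1 := phase_mul_phase_not true
  simp [h1, h2, phase_mul_phase_not]

/-- Changing `s` reverses every rotation, and the Hadamard layers are involutions. This holds on
arbitrary states, so also after the sign. -/
theorem countLayers_inv (t : ℕ) (ψ : State (Site n m)) :
    runLayers (countLayers n m t false) (runLayers (countLayers n m t true) ψ) = ψ := by
  have hh : ∀ ψ, runGates (denote (hadC n m)) (runGates (denote (hadC n m)) ψ) = ψ := by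
    intro ψ
    rw [hadC, denote_hadamard, runGates_hadamard_hadamard _ nodup_counters]
  rw [countLayers_apply, countLayers_apply, hh]
  simp only [← mul_assoc, countPhase_mul, one_mul]
  exact hh ψ

theorem card_lt_fin (N t : ℕ) :
    (Finset.univ.filter fun i : Fin N => i.1 < t).card = min t N := by
  rw [Fin.card_filter_val_lt, min_comm]

/-- With z = ζ for counter k: if the counter is zero, only the copies with input bit one are
rotated, giving z^|x|. If it is one, the first round gives z^(2 min(t, n+1) - (n+1)), and the second
gives z^(n-|x|) from the copies and z from the counter. The common factor z^|x| does not depend on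
the counters. -/
theorem countPhase_supported (t : ℕ) (x : Fin n → Bool) (b : Site n m → Bool)
    (hb : Supported x b) : countPhase t true b =
      (∏ k : Fin m, zeta (2 ^ (k.1 + 2)) ^ weight x) * ∏ k : Fin m,
        if b (C k (Fin.last n)) then
          zeta (2 ^ (k.1 + 2)) ^ (2 * ((min t (n + 1) : ℕ) - weight x : ℤ)) else 1 := by
  obtain ⟨hX, hC, -⟩ := hb
  rw [countPhase, ← Finset.prod_mul_distrib, ← Finset.prod_mul_distrib]
  refine Finset.prod_congr rfl fun k _ => ?_
  set z := zeta (2 ^ (k.1 + 2)) with hz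
  have hz0 : z ≠ 0 := zeta_ne_zero _
  have e1 : ∀ i, fanCMap b (C k i) = b (C k (Fin.last n)) := by
    intro i
    refine Fin.lastCases ?_ (fun i => ?_) i
    · simp [fanCMap]
    · simp [fanCMap, Fin.castSucc_ne_last, hC]
  have e2 : fanXMap (fanCMap b) (C k (Fin.last n)) = b (C k (Fin.last n)) := by
    simp [fanXMap, e1]
  have e3 : ∀ i : Fin n, fanXMap (fanCMap b) (C k i.castSucc) =
      xor (b (C k (Fin.last n))) (x i) := by
    intro i
    simp [fanXMap, fanCMap, hX, hC, Fin.castSucc_ne_last]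
  simp only [e1]
  rw [Fin.prod_univ_castSucc (n := n) (f := fun i =>
    phase true (2 ^ (k.1 + 2)) (fanXMap (fanCMap b) (C k i)))]
  simp only [e2, e3]
  cases b (C k (Fin.last n)) with
  | false =>
    simp only [phase, Bool.false_eq_true, if_false, Finset.prod_const_one, one_mul, mul_one,
      Bool.false_xor, if_true, ← hz]
    rw [Finset.prod_ite, Finset.prod_const_one, mul_one, Finset.prod_const]
    rfl
  | true =>
    simp only [phase, if_true, Bool.true_xor, ← hz]
    have h1 : ∏ i : Fin (n + 1), (if (true == decide (i.1 < t)) = true then z else z⁻¹) =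
        z ^ (2 * (min t (n + 1) : ℕ) - (n + 1) : ℤ) := by
      have hc := Finset.card_filter_add_card_filter_not (s := Finset.univ)
        (fun i : Fin (n + 1) => i.1 < t)
      have hc1 := card_lt_fin (n + 1) t
      simp only [Finset.card_univ, Fintype.card_fin] at hc
      simp only [beq_iff_eq, true_eq_decide_iff]
      rw [Finset.prod_ite, Finset.prod_const, Finset.prod_const, inv_pow, ← zpow_natCast,
        ← zpow_natCast, ← zpow_neg, ← zpow_add₀ hz0]
      congr 1
      omega
    have h2 : ∏ i : Fin n, (if (!x i) = true then z else 1) = z ^ ((n : ℤ) - weight x) := by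
      have hc := Finset.card_filter_add_card_filter_not (s := Finset.univ) (fun i => x i = true)
      simp only [Finset.card_univ, Fintype.card_fin] at hc
      rw [Finset.prod_ite, Finset.prod_const_one, mul_one, Finset.prod_const, ← zpow_natCast]
      congr 1
      have : weight x = (Finset.univ.filter fun i => x i = true).card := rfl
      rw [this]
      have e : (Finset.univ.filter fun i => (!x i) = true) =
          Finset.univ.filter fun i => ¬ x i = true := by
        ext i; simp
      rw [e]
      omega
    rw [h1, h2, ← zpow_natCast z (weight x), ← zpow_add_one₀ hz0, ← zpow_add₀ hz0,
      ← zpow_add₀ hz0]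
    congr 1
    ring

/-- A counter turns by a half for a nonzero difference. -/
theorem exists_zeta_zpow_eq_neg_one (w : ℤ) (hw : w ≠ 0) (hwm : w.natAbs < 2 ^ m) :
    ∃ k : Fin m, zeta (2 ^ (k.1 + 2)) ^ (2 * w) = -1 := by
  -- The counter to choose is the 2-adic valuation `v` of `w`: its phase is (-1) to an odd power.
  obtain ⟨v, u, hu, hvu⟩ := Nat.exists_eq_two_pow_mul_odd (Int.natAbs_ne_zero.2 hw)
  have hv : v < m := by
    have : 2 ^ v ≤ w.natAbs := by
      rw [hvu]; exact Nat.le_mul_of_pos_right _ hu.pos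
    exact (Nat.pow_lt_pow_iff_right (by norm_num)).1 (this.trans_lt hwm)
  refine ⟨⟨v, hv⟩, ?_⟩
  have hnat : zeta (2 ^ (v + 2)) ^ ((2 * w.natAbs : ℕ) : ℤ) = -1 := by
    rw [zpow_natCast, hvu, show 2 * (2 ^ v * u) = 2 ^ (v + 1) * u by ring, pow_mul,
      zeta_half (v + 1), hu.neg_one_pow]
  rcases Int.natAbs_eq w with h | h
  · rw [h]; exact_mod_cast hnat
  · rw [show 2 * w = -((2 * w.natAbs : ℕ) : ℤ) by omega, zpow_neg, hnat]
    norm_num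

/-- The circuit on a basis state. -/
theorem exactLayers_apply (hm : n + 2 ≤ 2 ^ m) (t : ℕ) (x : Fin n → Bool) (y : Bool) :
    runLayers (exactLayers n m t)
      (prodState (cleanState x (fun β => if β = y then 1 else 0)
        fun _ β => if β = false then 1 else 0)) =
      prodState (cleanState x (fun β => if β = xor y (exact n t x) then 1 else 0)
        fun _ β => if β = false then 1 else 0) := by
  classical
  set δ : Fin m → Bool → ℂ := fun _ β => if β = false then 1 else 0 with hδ
  set g : ℂ := ∏ k : Fin m, zeta (2 ^ (k.1 + 2)) ^ weight x
  set w : ℤ := (min t (n + 1) : ℕ) - weight x with hw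
  set ω : Fin m → ℂ := fun k => zeta (2 ^ (k.1 + 2)) ^ (2 * w) with hω
  set u : Fin m → Bool → ℂ := fun k =>
    hadTransform fun β => (if β then ω k else 1) * hadTransform (δ k) β with hu
  have hcount : ∀ η, runLayers (countLayers n m t true) (prodState (cleanState x η δ)) =
      fun b => g * prodState (cleanState x η u) b := by
    intro η
    rw [countLayers_apply, runGates_hadC]
    have e : (fun b => countPhase t true b *
        prodState (cleanState x η fun k => hadTransform (δ k)) b) = fun b => g * prodState
          (cleanState x η fun k β => (if β then ω k else 1) * hadTransform (δ k) β) b := by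
      funext b
      rw [prodState_cleanState, prodState_cleanState]
      split_ifs with hb
      · rw [countPhase_supported t x b hb, Finset.prod_mul_distrib]
        ring
      · simp
    rw [e, runGates_smul, runGates_hadC]
  have hwt : weight x ≤ n := by
    refine (Finset.card_le_univ _).trans ?_
    simp
  -- Truncating `t` at `n + 1` is harmless because no weight exceeds `n`.
  have hw0 : exact n t x = true ↔ w = 0 := by
    simp only [exact, decide_eq_true_eq]
    omega
  -- The counter is `H · diag(1, ω k) · H` applied to the zero state.
  have hu0 : ∀ k, u k = fun β => (1 + (if β then -1 else 1) * ω k) / 2 := by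
    intro k
    have h2 : (√2 : ℂ) * (√2 : ℂ) = 2 := by
      rw [← Complex.ofReal_mul, Real.mul_self_sqrt (by norm_num)]; norm_num
    have h0 : (√2 : ℂ) ≠ 0 := fun h => by simp [h] at h2
    funext β
    simp only [hu, hδ, hadTransform]
    field_simp
    rw [pow_two, h2]
    simp
    ring
  set η' : (Bool → ℂ) → Bool → ℂ := fun η β =>
    if exact n t x = true ∧ β = true then - η β else η β with hη'
  have hsign : ∀ η, runLayers (signLayers n m) (fun b => g * prodState (cleanState x η u) b) =
      fun b => g * prodState (cleanState x (η' η) u) b := by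
    intro η
    obtain ⟨f, hf1, hf2⟩ := signLayers_apply (n := n) (m := m)
    funext b
    rw [hf1, prodState_cleanState, prodState_cleanState]
    split_ifs with hb
    · rw [hf2 b hb.2.2]
      -- If `w = 0`, basis states with a nonzero counter have amplitude zero. Otherwise some `ω k =
      -- -1`, and basis states with all counters zero have amplitude zero. So on the support the
      -- sign depends only on `x` and the output bit.
      by_cases hex : exact n t x = true
      · have hω1 : ∀ k, ω k = 1 := fun k => by simp [hω, hw0.1 hex]
        by_cases hall : ∀ k, b (C k (Fin.last n)) = false
        · simp only [hη', hex, true_and]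
          cases b Y <;> simp [hall]
        · push Not at hall
          obtain ⟨k, hk⟩ := hall
          have : ∏ k, u k (b (C k (Fin.last n))) = 0 :=
            Finset.prod_eq_zero (Finset.mem_univ k) (by simp [hu0, hω1, hk])
          rw [this]
          simp
      · have hne : w ≠ 0 := fun h => hex (hw0.2 h)
        obtain ⟨k, hk⟩ := exists_zeta_zpow_eq_neg_one (m := m) w hne (by omega)
        cases hbk : b (C k (Fin.last n)) with
        | false =>
          have : ∏ k, u k (b (C k (Fin.last n))) = 0 := by
            refine Finset.prod_eq_zero (Finset.mem_univ k) ?_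
            have hk' : ω k = -1 := hk
            simp [hu0, hbk, hk']
          rw [this]
          simp
        | true =>
          have : ¬ (b Y = true ∧ ∀ k, b (C k (Fin.last n)) = false) := by
            rintro ⟨-, h⟩
            rw [h k] at hbk
            exact absurd hbk (by simp)
          simp [this, hη', hex]
    · simp
  have hY : ∀ η c, runLayers [hadY n m] (prodState (cleanState x η c)) =
      prodState (cleanState x (hadTransform η) c) := by
    intro η c
    rw [← runGates_hadY]
    simp [runLayers]
  -- The sign has become a change of the output factor alone. Rewriting back with `hcount` moves it
  -- in front of the counting layers, which then cancel.
  rw [exactLayers, runLayers_append, runLayers_append, runLayers_append, runLayers_append, hY,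
    hcount, hsign, ← hcount, countLayers_inv, hY]
  congr 2
  -- A conditional sign between Hadamard gates is a bit flip.
  have hη : η' (hadTransform fun β => if β = y then 1 else 0) =
      hadTransform fun β => if β = xor y (exact n t x) then 1 else 0 := by
    funext β
    simp only [hη', hadTransform]
    cases exact n t x <;> cases y <;> cases β <;> simp <;> ring
  rw [hη, hadTransform_hadTransform]

/-- The circuit computes the gate `exact[t]`. -/
theorem exactCircuit_computesExactly (hm : n + 2 ≤ 2 ^ m) (t : ℕ) :
    ((exactCircuit n m t).map GateWord.gate).ComputesExactly (exact n t) := by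
  intro x y
  have hin : ∀ y, (fun b : Site n m → Bool => inputState (numAncilla n m) x y
      (b ∘ (equivWire (n := n) (m := m)).symm)) =
      prodState (cleanState x (fun β => if β = y then 1 else 0)
        fun _ β => if β = false then 1 else 0) := by
    intro y
    have : (prodState (cleanState x (fun β => if β = y then 1 else 0)
        fun _ β => if β = false then 1 else 0) : State (Site n m)) =
        prodState fun s β => if β = (Sum.elim x (Sum.elim (fun _ => y) (fun _ => false)) :
          Wire n (numAncilla n m) → Bool) (equivWire s) then 1 else 0 := by
      congr 1
      funext s β
      cases s with
      | C k i => by_cases hi : i = Fin.last n <;> simp [cleanState, equivWire, equivSum, hi]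
      | _ => simp [cleanState, equivWire, equivSum]
    rw [this, ← single_eq_prodState]
    funext b
    rw [inputState, Pi.single_apply, Pi.single_apply]
    congr 1
    rw [eq_iff_iff]
    constructor
    · intro h
      funext s
      rw [← h]
      simp
    · rintro rfl
      funext s
      simp
  have hrun : ((exactCircuit n m t).map GateWord.gate).run (inputState (numAncilla n m) x y) =
      runGates ((denote (exactLayers n m t).flatten).map (Gate.relabel equivWire))
        (inputState (numAncilla n m) x y) := by
    rw [Circuit.run, runGates]
    congr 1
    simp only [Circuit.map, exactCircuit, denote, List.map_map, List.map_flatten]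
    congr 1
    refine List.map_congr_left fun L _ => ?_
    simp [Gate.map_relabel]
  rw [hrun]
  funext b
  have hb : b = (b ∘ equivWire) ∘ (equivWire (n := n) (m := m)).symm := by
    funext s; simp
  rw [hb, runGates_relabel, hin y]
  have h := exactLayers_apply hm t x y
  rw [runLayers] at h
  rw [h, ← hin]

end Semantics

open Site

/-! ### The description of the circuit -/

/-- The description of a gate. -/
def encodeSite {n m : ℕ} : Gate GateWord (Site n m) → List Symbol
  | .one w i => .one :: (w.flatMap Letter.encode ++ encodeNat (index i))
  | .fanout c T => .fan :: (encodeNat (index c) ++ T.flatMap fun i => encodeNat (index i))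

theorem encode_relabel {n m : ℕ} (g : Gate GateWord (Site n m)) :
    (g.relabel equivWire).encode = encodeSite g := by
  cases g with
  | one w i => rfl
  | fanout c T => simp only [Gate.relabel, Gate.encode, List.flatMap_map]; rfl

/-- The description of a layer. -/
def encodeLayer {n m : ℕ} (L : Layer n m) : List Symbol := .layer :: L.flatMap encodeSite

theorem encode_exactCircuit (n m t : ℕ) : (exactCircuit n m t).encode =
    encodeNat n ++ encodeNat (numAncilla n m) ++ (exactLayers n m t).flatMap encodeLayer := by
  simp only [Circuit.encode, exactCircuit, List.flatMap_map, encode_relabel]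
  rfl

/-- Generating programs for descriptions. The registers `0, …, 7` contain `n`, `t`, `n + 1`, `n + 2`,
`2 ^ m`, `m`, `0`, and `2 ^ (m + 1)`. -/
abbrev Printer : Type := Gen 16 Symbol

/-! ### Printing programs -/

namespace Printer

open Gen

infixr:65 " ;; " => Gen.seq

/-- The number in register `r`, in unary. -/
def ticks (d r : Fin 16) : Printer := forLt d r (emit .tick)

/-- The product of two registers, in unary. -/
def ticksMul (d r s : Fin 16) : Printer := forLt d r (ticks (d + 1) s)

/-- The number of the qubit `X i`. -/
def siteX (d i : Fin 16) : Printer := ticks d i ;; emit .sep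

/-- The number of the qubit `Y`. -/
def siteY (d : Fin 16) : Printer := ticks d 0 ;; emit .sep

/-- The number of the qubit `C k i`. -/
def siteC (d k i : Fin 16) : Printer := ticks d 2 ;; ticks d i ;; ticksMul d k 2 ;; emit .sep

/-- The number of the qubit `E k a`. -/
def siteE (d k a : Fin 16) : Printer :=
  ticks d 2 ;; ticksMul d 5 2 ;; ticks d a ;; ticksMul d k 4 ;; emit .sep

/-- The number of the qubit `D a`. -/
def siteD (d a : Fin 16) : Printer :=
  ticks d 2 ;; ticksMul d 5 2 ;; ticksMul d 5 4 ;; ticks d a ;; emit .sep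

/-- The description of a rotation word. -/
def rotation (s : Bool) (d q : Fin 16) : Printer :=
  emit .rot ;; (bif s then emit .tick else forLt d q (ite (.lt 6 d) (emit .tick) nil)) ;;
    emit .sep ;; ticks d q ;; emit .sep

def hadY : Printer := emit .layer ;; emit .one ;; emit .had ;; siteY 8

def hadC : Printer := emit .layer ;; forLt 8 5 (emit .one ;; emit .had ;; siteC 9 8 0)

def fanC : Printer := emit .layer ;; forLt 8 5 (emit .fan ;; siteC 9 8 0 ;; forLt 9 0 (siteC 10 8 9))

/-- Register `8` is the counter k, `11` holds 2^(k+2), and `13` is the copy, which `c` may compare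
with `t` in register `1`. -/
def phaseC (c : Cond 16) (s s' : Bool) : Printer :=
  emit .layer ;; forLt 8 5 (letAdd 9 (some 8) none true (letAdd 10 (some 9) none true
    (letPow 11 12 10 (forLt 13 2
      (emit .one ;; ite c (rotation s 14 11) (rotation s' 14 11) ;; siteC 14 8 13)))))

def fanX : Printer := emit .layer ;; forLt 8 0 (emit .fan ;; siteX 9 8 ;; forLt 9 5 (siteC 10 9 8))

/-- Register `9` holds 2^k, so that `meet` tests bit k of `a` in register `11`. -/
def copyE : Printer := emit .layer ;; forLt 8 5 (emit .fan ;; siteC 9 8 0 ;;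
  letPow 9 10 8 (forLt 11 4 (ite (.meet 11 9) (siteE 12 8 11) nil)))

def hadE : Printer := emit .layer ;; forLt 8 4 ((emit .one ;; emit .had ;; siteD 9 8) ;;
  forLt 9 5 (emit .one ;; emit .had ;; siteE 10 9 8))

def fanD : Printer := emit .layer ;; forLt 8 4 (emit .fan ;; siteD 9 8 ;; forLt 9 5 (siteE 10 9 8))

def phaseD (s : Bool) : Printer :=
  emit .layer ;; forLt 8 4 (emit .one ;; rotation s 9 7 ;; siteD 9 8)

def fanY : Printer := emit .layer ;; emit .fan ;; siteY 8 ;; forLt 8 4 (siteD 9 8)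

def countLayers (s : Bool) : Printer :=
  hadC ;; fanC ;; phaseC (.lt 13 1) s (!s) ;; fanX ;; phaseC (.lt 13 1) s s ;; fanX ;; fanC ;; hadC

def signLayers : Printer :=
  copyE ;; hadE ;; fanD ;; hadE ;; phaseD false ;; fanY ;; phaseD true ;; fanY ;;
    hadE ;; fanD ;; hadE ;; copyE

/-- The descriptions of all layers. -/
def layers : Printer := hadY ;; countLayers true ;; signLayers ;; countLayers false ;; hadY

/-- The numbers of input and ancilla qubits. -/
def header : Printer := (ticks 8 0 ;; emit .sep) ;;
  (ticksMul 8 5 2 ;; ticksMul 8 5 4 ;; ticks 8 4 ;; emit .sep)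

/-- The program that prints the description of the circuit. -/
def printer : Printer :=
  letAdd 2 (some 0) none true (letAdd 3 (some 2) none true (letClog 4 5 3
    (letAdd 6 none none false (letAdd 7 (some 4) (some 4) false (header ;; layers)))))

/-- The contents of the registers. -/
structure Env (n m t : ℕ) (ρ : Fin 16 → ℕ) : Prop where
  r0 : ρ 0 = n
  r1 : ρ 1 = t
  r2 : ρ 2 = n + 1
  r4 : ρ 4 = 2 ^ m
  r5 : ρ 5 = m
  r6 : ρ 6 = 0
  r7 : ρ 7 = 2 ^ (m + 1)

theorem eval_ticks (d r : Fin 16) (ρ : Fin 16 → ℕ) :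
    (ticks d r).eval ρ = List.replicate (ρ r) .tick := by
  simp only [ticks, eval]
  rw [List.eq_replicate_iff]
  simp

/-- The outer loop overwrites `d` before `s` is read; `r` is read only before that. -/
theorem eval_ticksMul (d r s : Fin 16) (hs : s ≠ d) (ρ : Fin 16 → ℕ) :
    (ticksMul d r s).eval ρ = List.replicate (ρ r * ρ s) .tick := by
  simp only [ticksMul, eval, eval_ticks, Function.update_of_ne hs]
  rw [List.eq_replicate_iff]
  simp

theorem eval_siteX (d i : Fin 16) (ρ : Fin 16 → ℕ) : (siteX d i).eval ρ = encodeNat (ρ i) := by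
  simp [siteX, eval, eval_ticks, encodeNat]

theorem eval_siteY (d : Fin 16) (ρ : Fin 16 → ℕ) : (siteY d).eval ρ = encodeNat (ρ 0) := by
  simp [siteY, eval, eval_ticks, encodeNat]

theorem eval_siteC (d k i : Fin 16) (h2 : 2 ≠ d) (ρ : Fin 16 → ℕ) :
    (siteC d k i).eval ρ = encodeNat (ρ 2 + (ρ i + ρ 2 * ρ k)) := by
  simp only [siteC, eval, eval_ticks, eval_ticksMul _ _ _ h2, encodeNat]
  rw [List.replicate_add, List.replicate_add, mul_comm]
  simp only [List.append_assoc]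

theorem eval_siteE (d k a : Fin 16) (h2 : 2 ≠ d) (h4 : 4 ≠ d) (ρ : Fin 16 → ℕ) :
    (siteE d k a).eval ρ = encodeNat (ρ 2 + (ρ 5 * ρ 2 + (ρ a + ρ 4 * ρ k))) := by
  simp only [siteE, eval, eval_ticks, eval_ticksMul _ _ _ h2, eval_ticksMul _ _ _ h4, encodeNat]
  rw [List.replicate_add, List.replicate_add, List.replicate_add, mul_comm (ρ 4)]
  simp only [List.append_assoc]

theorem eval_siteD (d a : Fin 16) (h2 : 2 ≠ d) (h4 : 4 ≠ d) (ρ : Fin 16 → ℕ) :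
    (siteD d a).eval ρ = encodeNat (ρ 2 + (ρ 5 * ρ 2 + (ρ 5 * ρ 4 + ρ a))) := by
  simp only [siteD, eval, eval_ticks, eval_ticksMul _ _ _ h2, eval_ticksMul _ _ _ h4, encodeNat]
  rw [List.replicate_add, List.replicate_add, List.replicate_add]
  simp only [List.append_assoc]

theorem eval_rotation (s : Bool) (d q : Fin 16) (h6 : 6 ≠ d) (ρ : Fin 16 → ℕ) (h : ρ 6 = 0) :
    (rotation s d q).eval ρ = (phaseWord s (ρ q)).flatMap Letter.encode := by
  -- The numerator `q - 1` is printed without subtraction: the round `i = 0` is skipped.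
  have h1 : (List.range (ρ q)).flatMap (fun i => bif decide (0 < i) then [Symbol.tick] else []) =
      List.replicate (ρ q - 1) .tick := by
    cases ρ q with
    | zero => rfl
    | succ N =>
      rw [List.range_succ_eq_map, List.flatMap_cons, List.flatMap_map, List.eq_replicate_iff]
      simp
  cases s
  · simp [rotation, eval, eval_ticks, phaseWord, Letter.encode, encodeNat, Cond.holds,
      Function.update_of_ne h6, h, h1]
  · simp [rotation, eval, eval_ticks, phaseWord, Letter.encode, encodeNat]

theorem flatMap_range {α : Type} (N : ℕ) (f : ℕ → List α) :
    (List.range N).flatMap f = (List.finRange N).flatMap fun i => f i.1 := by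
  have h : List.range N = (List.finRange N).map Fin.val := List.ext_getElem (by simp) (by simp)
  rw [h, List.flatMap_map]

/-! ### The printed layers -/

section Layers

variable {n m t : ℕ} {ρ : Fin 16 → ℕ}

theorem eval_hadY (h : Env n m t ρ) : hadY.eval ρ = encodeLayer (FanoutCircuit.hadY n m) := by
  simp [hadY, eval, eval_siteY, h.r0, encodeLayer, FanoutCircuit.hadY, encodeSite, Letter.encode,
    index_Y]

theorem eval_hadC (h : Env n m t ρ) : hadC.eval ρ = encodeLayer (FanoutCircuit.hadC n m) := by
  simp [hadC, eval, eval_siteC, h.r0, h.r2, h.r5, encodeLayer, FanoutCircuit.hadC, encodeSite,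
    Letter.encode, index_C, flatMap_range, List.flatMap_map]

theorem eval_fanC (h : Env n m t ρ) : fanC.eval ρ = encodeLayer (FanoutCircuit.fanC n m) := by
  simp [fanC, eval, eval_siteC, h.r0, h.r2, h.r5, encodeLayer, FanoutCircuit.fanC, encodeSite,
    index_C, flatMap_range, List.flatMap_map]

theorem eval_fanX (h : Env n m t ρ) : fanX.eval ρ = encodeLayer (FanoutCircuit.fanX n m) := by
  simp [fanX, eval, eval_siteC, eval_siteX, h.r0, h.r2, h.r5, encodeLayer, FanoutCircuit.fanX,
    encodeSite, index_C, index_X, flatMap_range, List.flatMap_map]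

theorem eval_hadE (h : Env n m t ρ) : hadE.eval ρ = encodeLayer (FanoutCircuit.hadE n m) := by
  simp [hadE, eval, eval_siteD, eval_siteE, h.r2, h.r4, h.r5, encodeLayer, FanoutCircuit.hadE,
    encodeSite, Letter.encode, index_D, index_E, flatMap_range, List.flatMap_map, List.map_flatMap,
    List.flatMap_assoc]

theorem eval_fanD (h : Env n m t ρ) : fanD.eval ρ = encodeLayer (FanoutCircuit.fanD n m) := by
  simp [fanD, eval, eval_siteD, eval_siteE, h.r2, h.r4, h.r5, encodeLayer, FanoutCircuit.fanD,
    encodeSite, index_D, index_E, flatMap_range, List.flatMap_map]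

theorem eval_fanY (h : Env n m t ρ) : fanY.eval ρ = encodeLayer (FanoutCircuit.fanY n m) := by
  simp [fanY, eval, eval_siteD, eval_siteY, h.r0, h.r2, h.r4, h.r5, encodeLayer,
    FanoutCircuit.fanY, encodeSite, index_D, index_Y, flatMap_range, List.flatMap_map]

theorem eval_phaseD (h : Env n m t ρ) (s : Bool) :
    (phaseD s).eval ρ = encodeLayer (FanoutCircuit.phaseD n m s) := by
  simp [phaseD, eval, eval_siteD, eval_rotation, h.r2, h.r4, h.r5, h.r6, h.r7, encodeLayer,
    FanoutCircuit.phaseD, encodeSite, index_D, flatMap_range, List.flatMap_map]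

theorem flatMap_filter {α β : Type} (p : α → Bool) (f : α → List β) (L : List α) :
    (L.filter p).flatMap f = L.flatMap fun a => bif p a then f a else [] := by
  induction L with
  | nil => rfl
  | cons a L ih => cases h : p a <;> simp [h, ih]

theorem decide_land_two_pow (a k : ℕ) : decide (a &&& 2 ^ k = 0) = !a.testBit k := by
  rw [Nat.and_two_pow]
  cases a.testBit k <;> simp

theorem eval_copyE (h : Env n m t ρ) : copyE.eval ρ = encodeLayer (FanoutCircuit.copyE n m) := by
  simp [copyE, eval, eval_siteC, eval_siteE, h.r0, h.r2, h.r4, h.r5, encodeLayer,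
    FanoutCircuit.copyE, encodeSite, index_C, index_E, flatMap_range, List.flatMap_map, Cond.holds,
    decide_land_two_pow, flatMap_filter]

theorem eval_phaseC (h : Env n m t ρ) (s s' : Bool) :
    (phaseC (.lt 13 1) s s').eval ρ =
      encodeLayer (FanoutCircuit.phaseC n m fun i => bif decide (i < t) then s else s') := by
  have hb : ∀ (b : Bool) (q : ℕ), (bif b then (phaseWord s q).flatMap Letter.encode else
      (phaseWord s' q).flatMap Letter.encode) =
      (phaseWord (bif b then s else s') q).flatMap Letter.encode := by
    intro b q; cases b <;> rfl
  simp [phaseC, eval, eval_siteC, eval_rotation, h.r1, h.r2, h.r5, h.r6, encodeLayer,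
    FanoutCircuit.phaseC, encodeSite, index_C, flatMap_range, List.flatMap_map, Cond.holds,
    List.flatMap_assoc, operand, hb]

theorem eval_countLayers (h : Env n m t ρ) (s : Bool) : (countLayers s).eval ρ =
    (FanoutCircuit.countLayers n m t s).flatMap encodeLayer := by
  have e1 : (fun i => s == decide (i < t)) = fun i => bif decide (i < t) then s else !s := by
    funext i; cases s <;> cases decide (i < t) <;> rfl
  have e2 : (fun _ => s) = fun i => bif decide (i < t) then s else s := by
    funext i; cases decide (i < t) <;> rfl
  rw [FanoutCircuit.countLayers, e1, e2]
  simp [countLayers, eval, eval_hadC h, eval_fanC h, eval_phaseC h, eval_fanX h]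

theorem eval_signLayers (h : Env n m t ρ) : signLayers.eval ρ =
    (FanoutCircuit.signLayers n m).flatMap encodeLayer := by
  simp [signLayers, FanoutCircuit.signLayers, eval, eval_copyE h, eval_hadE h, eval_fanD h,
    eval_phaseD h, eval_fanY h]

theorem eval_layers (h : Env n m t ρ) : layers.eval ρ =
    (exactLayers n m t).flatMap encodeLayer := by
  simp [layers, exactLayers, eval, eval_hadY h, eval_countLayers h, eval_signLayers h]

theorem eval_header (h : Env n m t ρ) : header.eval ρ =
    encodeNat n ++ encodeNat (numAncilla n m) := by
  simp [header, eval, eval_ticks, eval_ticksMul, h.r0, h.r2, h.r4, h.r5, encodeNat, numAncilla]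
  rw [List.replicate_add, List.replicate_add, List.append_assoc, List.append_assoc]

/-- All registers that are bound in the layers are bounded. -/
theorem layers_bounded (h : Env n m t ρ) {B : ℕ} (hB : 2 ^ (m + 1) < B) :
    (header ;; layers).Bounded B ρ := by
  -- Since `k + 2 ≤ m + 1`, the largest order of a rotation that is needed is `2 ^ (m + 1)`.
  have hk : ∀ k < m, 2 ^ k < B ∧ 2 ^ (k + 2) < B ∧ k + 1 < B ∧ k + 1 + 1 < B := by
    intro k hk
    have h1 : 2 ^ k ≤ 2 ^ (m + 1) := Nat.pow_le_pow_right (by norm_num) (by omega)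
    have h2 : 2 ^ (k + 2) ≤ 2 ^ (m + 1) := Nat.pow_le_pow_right (by norm_num) (by omega)
    have h3 : k + 2 < 2 ^ (k + 2) := Nat.lt_two_pow_self
    omega
  have hphase : ∀ s s', (phaseC (.lt 13 1) s s').Bounded B ρ := by
    intro s s'
    cases s <;> cases s' <;>
      simpa [phaseC, Bounded, siteC, rotation, ticks, ticksMul, h.r5, operand] using
        fun k hkm => ⟨(hk k hkm).2.2.1, (hk k hkm).2.2.2, (hk k hkm).2.1⟩
  have hcopy : copyE.Bounded B ρ := by
    simpa [copyE, Bounded, siteC, siteE, ticks, ticksMul, h.r5] using fun k hkm => (hk k hkm).1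
  have hfree : header.Bounded B ρ ∧ hadY.Bounded B ρ ∧ hadC.Bounded B ρ ∧ fanC.Bounded B ρ ∧
      fanX.Bounded B ρ ∧ hadE.Bounded B ρ ∧ fanD.Bounded B ρ ∧ fanY.Bounded B ρ := by
    simp [header, hadY, hadC, fanC, fanX, hadE, fanD, fanY, Bounded, siteX, siteY, siteC, siteD,
      siteE, ticks, ticksMul]
  have hphaseD : ∀ s, (phaseD s).Bounded B ρ := by
    intro s
    cases s <;> simp [phaseD, Bounded, rotation, siteD, ticks, ticksMul]
  obtain ⟨f1, f2, f3, f4, f5, f6, f7, f8⟩ := hfree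
  simp [layers, countLayers, signLayers, Bounded, *]

end Layers

theorem env_printer (n t : ℕ) : Env n (Nat.clog 2 (n + 2)) t
    (Function.update (Function.update (Function.update (Function.update (Function.update
      (Function.update (inputRegs n t) 2 (n + 1)) 3 (n + 2)) 4 (2 ^ Nat.clog 2 (n + 2))) 5
        (Nat.clog 2 (n + 2))) 6 0) 7 (2 ^ (Nat.clog 2 (n + 2) + 1))) := by
  constructor <;> simp [inputRegs]

theorem eval_printer (n t : ℕ) :
    printer.eval (inputRegs n t) = (exactCircuit n (Nat.clog 2 (n + 2)) t).encode := by
  have h := env_printer n t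
  rw [encode_exactCircuit, ← eval_layers h, ← eval_header h]
  simp [printer, eval, operand, inputRegs, pow_succ, mul_two]

/-- The power below the rounded one is still less than `n + 2`. This makes the number of parities
linear in `n`. -/
theorem two_pow_clog_lt (n : ℕ) : 2 ^ Nat.clog 2 (n + 2) < 2 * (n + 2) := by
  have h := Nat.pow_pred_clog_lt_self (b := 2) (by norm_num) (by omega : 1 < n + 2)
  have h0 : 0 < Nat.clog 2 (n + 2) := Nat.clog_pos (by norm_num) (by omega)
  obtain ⟨c, hc⟩ : ∃ c, Nat.clog 2 (n + 2) = c + 1 := ⟨_, (Nat.succ_pred_eq_of_pos h0).symm⟩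
  rw [hc] at h ⊢
  simp only [Nat.pred_eq_sub_one, Nat.add_sub_cancel] at h
  rw [pow_succ]
  omega

theorem printer_bounded (n t : ℕ) :
    printer.Bounded (2 ^ (4 * Nat.log 2 (n + t + 3))) (inputRegs n t) := by
  set B := 2 ^ (4 * Nat.log 2 (n + t + 3)) with hBdef
  have hlog : 1 ≤ Nat.log 2 (n + t + 3) := Nat.log_pos (by norm_num) (by omega)
  have h1 := two_pow_clog_lt n
  have h2 : n + t + 3 < 2 ^ (Nat.log 2 (n + t + 3) + 1) := Nat.lt_pow_succ_log_self (by norm_num) _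
  -- The largest register `2 ^ (m + 1)` is below `4 * (n + 2)`. Absorbing this factor takes `log + 3
  -- ≤ 4 * log`, whence the constant `4`.
  have h3 : 2 ^ (Nat.log 2 (n + t + 3) + 1) * 2 ^ 2 ≤ B := by
    rw [← pow_add, hBdef]
    exact Nat.pow_le_pow_right (by norm_num) (by omega)
  have hB : 2 ^ (Nat.clog 2 (n + 2) + 1) < B := by
    rw [pow_succ]
    omega
  have h := layers_bounded (env_printer n t) hB
  rw [pow_succ] at hB
  have hnn : n + 1 + 1 = n + 2 := rfl
  simp only [printer, Bounded]
  refine ⟨?_, ?_, ?_, ?_, ?_, ?_⟩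
  · simp [operand, inputRegs]; omega
  · simp [operand, inputRegs]; omega
  · simp [operand, inputRegs, hnn]; omega
  · simp [operand]; omega
  · simp [operand, inputRegs, hnn]; omega
  · simpa [operand, inputRegs, pow_succ, mul_two, hnn, Bounded] using h

theorem printer_wf : printer.WF 2 = true := by decide

end Printer

/-- The descriptions of the circuits are generated in logarithmic space. -/
theorem logSpaceGenerated_exactCircuit :
    LogSpaceGenerated fun n t => (exactCircuit n (Nat.clog 2 (n + 2)) t).encode := by
  have h := Gen.logSpaceGenerated (R := 14) Printer.printer Printer.printer_wf 4 (by norm_num)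
    Printer.printer_bounded
  simpa only [Printer.eval_printer] using h

/-! ### Depth and size -/

/-- The gates of a layer are disjoint, so a layer has size at most the number of qubits. -/
theorem size_le_card {n a : ℕ} {G : Type} (C : Circuit G n a) :
    C.size ≤ C.depth * (n + (1 + a)) := by
  have key : ∀ Ls : List (List (Gate G (Wire n a))), (∀ L ∈ Ls, (L.flatMap Gate.qubits).Nodup) →
      (Ls.flatten.map Gate.size).sum ≤ Ls.length * (n + (1 + a)) := by
    intro Ls
    induction Ls with
    | nil => simp
    | cons L Ls ih =>
      intro h
      have h1 := (h L (by simp)).length_le_card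
      rw [List.length_flatMap] at h1
      simp only [Fintype.card_sum, Fintype.card_fin] at h1
      have h2 := ih fun L hL => h L (by simp [hL])
      rw [List.flatten_cons, List.map_append, List.sum_append, List.length_cons, add_mul, one_mul]
      have h3 : (L.map Gate.size).sum ≤ n + (1 + a) := h1
      omega
  exact key C.layers C.nodup

theorem depth_exactCircuit (n m t : ℕ) : (exactCircuit n m t).depth = 30 := by
  simp [Circuit.depth, exactCircuit, exactLayers, countLayers, signLayers]

theorem one_le_logStar (n : ℕ) (hn : 1 ≤ n) : 1 ≤ logStar n := by
  refine (isGreatest_logStar n).2 ?_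
  intro j hj
  obtain rfl : j = 0 := by omega
  simpa using Nat.lt_of_succ_le hn

/-- For `n ≥ 2`, `2 ^ m ≤ 4 * n` and m ≤ 4 log₂ n, where the latter uses `2 ^ m ≤ n ^ 4`. Thus the
qubits for counters and parities, of order nm + m 2^m, number O(n log n); the constant is generous.
-/
theorem numAncilla_le (n : ℕ) (hn : 2 ≤ n) :
    ((n + (1 + numAncilla n (Nat.clog 2 (n + 2))) : ℕ) : ℝ) ≤ 40 * (n * Real.logb 2 n) := by
  set m := Nat.clog 2 (n + 2) with hm
  have h1 : 2 ^ m < 2 * (n + 2) := Printer.two_pow_clog_lt n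
  have hn' : (2 : ℝ) ≤ n := by exact_mod_cast hn
  have hl : 1 ≤ Real.logb 2 n := by
    rw [Real.le_logb_iff_rpow_le (by norm_num) (by linarith)]
    simpa using hn'
  have hml : (m : ℝ) ≤ 4 * Real.logb 2 n := by
    have h2 : 2 ^ m ≤ n ^ 4 := by
      have : n ^ 4 = n * (n * (n * n)) := by ring
      have a1 : 2 * 2 ≤ n * n := Nat.mul_le_mul hn hn
      have a2 : 2 * 4 ≤ n * (n * n) := Nat.mul_le_mul hn (by omega)
      have a3 : n * 8 ≤ n * (n * (n * n)) := Nat.mul_le_mul_left n (by omega)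
      omega
    have h3 : (2 : ℝ) ^ m ≤ (n : ℝ) ^ 4 := by exact_mod_cast h2
    have h4 := Real.logb_le_logb_of_le (by norm_num : (1 : ℝ) < 2) (by positivity) h3
    rw [Real.logb_pow, Real.logb_pow, Real.logb_self_eq_one (by norm_num)] at h4
    push_cast at h4
    linarith
  have h1' : (2 : ℝ) ^ m ≤ 4 * n := by
    have : 2 ^ m ≤ 4 * n := by omega
    exact_mod_cast this
  have hm0 : (0 : ℝ) ≤ m := Nat.cast_nonneg m
  push_cast [numAncilla]
  have e1 : (m : ℝ) * (n + 1) ≤ 4 * Real.logb 2 n * (2 * n) := by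
    apply mul_le_mul hml (by linarith) (by positivity) (by positivity)
  have e2 : (m : ℝ) * 2 ^ m ≤ 4 * Real.logb 2 n * (4 * n) :=
    mul_le_mul hml h1' (by positivity) (by positivity)
  have e3 : (n : ℝ) ≤ n * Real.logb 2 n := le_mul_of_one_le_right (by linarith) hl
  nlinarith

/-- The gates `exact[t]` are computed by circuits of constant depth and size `O(n log n)`. -/
theorem exactCircuit_bounds (n t : ℕ) (hn : 2 ≤ n) :
    (((exactCircuit n (Nat.clog 2 (n + 2)) t).map GateWord.gate).depth : ℝ) ≤ 1200 * logStar n ∧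
    (((exactCircuit n (Nat.clog 2 (n + 2)) t).map GateWord.gate).size : ℝ) ≤
      1200 * (n * Real.logb 2 n) := by
  -- The constant 1200 is 30 layers times the 40 of `numAncilla_le`; for the depth 30 would do.
  set C := (exactCircuit n (Nat.clog 2 (n + 2)) t).map GateWord.gate with hC
  have hd : C.depth = 30 := by
    rw [← depth_exactCircuit n (Nat.clog 2 (n + 2)) t]
    simp [hC, Circuit.depth, Circuit.map]
  constructor
  · have : (1 : ℝ) ≤ logStar n := by exact_mod_cast one_le_logStar n (by omega)
    rw [hd]
    push_cast
    linarith
  · have h1 : (C.size : ℝ) ≤ ((C.depth * (n + (1 + numAncilla n (Nat.clog 2 (n + 2)))) : ℕ) : ℝ) :=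
      by exact_mod_cast size_le_card C
    have h2 := numAncilla_le n hn
    rw [hd, Nat.cast_mul] at h1
    push_cast at h1 h2 ⊢
    linarith

/-- One family serves both claims; only the bound `s` on the size differs. -/
theorem computableExactly_exact (s : ℕ → ℝ) (hs : ∀ n : ℕ, 2 ≤ n → n * Real.logb 2 n ≤ s n) :
    ComputableExactly (fun n => (logStar n : ℝ)) s exact := by
  refine ⟨fun n _ => numAncilla n (Nat.clog 2 (n + 2)),
    fun n t => (exactCircuit n (Nat.clog 2 (n + 2)) t).map GateWord.gate,
    ⟨fun n t => exactCircuit n (Nat.clog 2 (n + 2)) t, fun _ _ => rfl,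
      logSpaceGenerated_exactCircuit⟩,
    fun n t => exactCircuit_computesExactly (Nat.le_pow_clog (by norm_num) _) t,
    1200, 2, fun n hn t => ?_⟩
  obtain ⟨h1, h2⟩ := exactCircuit_bounds n t hn
  exact ⟨h1, h2.trans (mul_le_mul_of_nonneg_left (hs n hn) (by norm_num))⟩

end FanoutCircuit

end

theorem mainTheorem6 :
    FanoutCircuit.exact ∈ FanoutCircuit.QNCf (fun n => (FanoutCircuit.logStar n : ℝ)) ∧
    FanoutCircuit.ComputableExactly (fun n => (FanoutCircuit.logStar n : ℝ))
      (fun n => n * Real.logb 2 n) FanoutCircuit.exact := by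
  -- Exponent `2` suffices, as log₂ n ≤ n.
  refine ⟨⟨2, FanoutCircuit.computableExactly_exact _ fun n hn => ?_⟩,
    FanoutCircuit.computableExactly_exact _ fun n _ => le_rfl⟩
  have h0 : (0 : ℝ) < n := by exact_mod_cast (by omega : 0 < n)
  have h := FanoutCircuit.logb_two_le n h0
  rw [pow_two]
  exact mul_le_mul_of_nonneg_left (by linarith) h0.le
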